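/- Let $A,B,m\ge 0$ be integers, $\Phi:\{1,\dots,B\}\to\{1,\dots,A\}$, and let $D\subseteq\mathbb{R}^m$ be a parameter set on which derivatives are uniquely determined (at every point of $D$ the tangent cone of $D$ spans $\mathbb{R}^m$; for instance $D$ open, or $D$ convex with non-empty interior). For $\varepsilon\in D$ let $\Delta=\Delta(\varepsilon)$ be a stochastic $B\times B$ matrix whose entries are real analytic on $D$ (near each point of $D$ they are given on $D$ by a convergent power series), let $Y=Y^{\varepsilon}=(Y_t)_{t\in\mathbb{Z}}$ be a stationary Markov chain with transition matrix $\Delta(\varepsilon)$, and let $Z=\Phi(Y)$ be the associated hidden Markov chain. Put $$H_n(Z)=H(Z_0\mid Z_{-n}^{-1})=-\sum_{z_{-n}^0}p(z_{-n}^0)\log p(z_0\mid z_{-n}^{-1}),\qquad H(Z)=\lim_{n\to\infty}H_n(Z),$$ both regarded as functions of $\varepsilon\in D$. For $a\in\{1,\dots,A\}$ let $\Delta_a$ be the matrix obtained from $\Delta$ by replacing every column $j$ with $\Phi(j)\ne a$ by zero. Suppose that $\hat\varepsilon\in D$ is a Black Hole: at $\varepsilon=\hat\varepsilon$, for every $a\in\{1,\dots,A\}$,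 $\Delta_a$ has rank one and every column of $\Delta_a$ is either strictly positive or zero. Then for every integer $N\ge 1$ the limit $H(Z)$ exists for all $\varepsilon\in D$ near $\hat\varepsilon$, the functions $H(Z)$ and $H_N(Z)$ are $N$ times continuously differentiable on $D$ near $\hat\varepsilon$, and for all non-negative integers $\alpha_1,\dots,\alpha_m$ with $\alpha_1+\cdots+\alpha_m=N$ $$\left.\frac{\partial^{N}H(Z)}{\partial\varepsilon_1^{\alpha_1}\cdots\partial\varepsilon_m^{\alpha_m}}\right|_{\varepsilon=\hat\varepsilon}=\left.\frac{\partial^{N}H_{N}(Z)}{\partial\varepsilon_1^{\alpha_1}\cdots\partial\varepsilon_m^{\alpha_m}}\right|_{\varepsilon=\hat\varepsilon},$$ where the order of the $N$ differentiations may be arbitrary, and derivatives are taken within $D$ (one-sided if $\hat\varepsilon$ is a boundary point of $D$). -/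

import Mathlib

open MeasureTheory Filter Topology

/-- `Y = (Y_t)_{t ∈ ℤ}` is a stationary Markov chain with transition matrix `Δ` on the
probability space `(Ω, P)`. -/
structure IsStationaryMarkovChain {Ω : Type*} [MeasurableSpace Ω] {B : ℕ}
    (P : Measure Ω) (Y : ℤ → Ω → Fin B) (Δ : Matrix (Fin B) (Fin B) ℝ) : Prop where
  isProbabilityMeasure : IsProbabilityMeasure P
  measurable : ∀ t, Measurable (Y t)
  /-- `P(Y_k = y_0, …, Y_{k+n} = y_n)` does not depend on the time `k`. -/
  stationary : ∀ (k : ℤ) (n : ℕ) (y : ℕ → Fin B),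
    P.real {ω | ∀ i ≤ n, Y (k + i) ω = y i} = P.real {ω | ∀ i ≤ n, Y i ω = y i}
  /-- `P(Y_k = y_0, …, Y_{k+n+1} = y_{n+1}) = P(Y_k = y_0, …, Y_{k+n} = y_n) Δ(y_n, y_{n+1})`. -/
  markov : ∀ (k : ℤ) (n : ℕ) (y : ℕ → Fin B),
    P.real {ω | ∀ i ≤ n + 1, Y (k + i) ω = y i} =
      P.real {ω | ∀ i ≤ n, Y (k + i) ω = y i} * Δ (y n) (y (n + 1))

/-- The hidden Markov chain `Z = Φ(Y)`. -/
def hiddenChain {Ω : Type*} {A B : ℕ} (Φ : Fin B → Fin A) (Y : ℤ → Ω → Fin B) :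
    ℤ → Ω → Fin A :=
  fun t ω => Φ (Y t ω)

/-- The conditional Shannon entropy
`H(X | W) = - ∑ P(X = x, W = w) log (P(X = x, W = w) / P(W = w))` of finitely valued random
variables. Terms with `P(X = x, W = w) = 0` vanish, in particular those with `P(W = w) = 0`. -/
noncomputable def condEntropy {Ω : Type*} [MeasurableSpace Ω] {α β : Type*} [Fintype α]
    [Fintype β] (P : Measure Ω) (X : Ω → α) (W : Ω → β) : ℝ :=
  -∑ x, ∑ w, P.real {ω | X ω = x ∧ W ω = w} *
    Real.log (P.real {ω | X ω = x ∧ W ω = w} / P.real {ω | W ω = w})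

/-- `H_n(Z) = H(Z_0 | Z_{-1}, …, Z_{-n})`. -/
noncomputable def entropyApprox {Ω : Type*} [MeasurableSpace Ω] {A : ℕ} (P : Measure Ω)
    (Z : ℤ → Ω → Fin A) (n : ℕ) : ℝ :=
  condEntropy P (Z 0) (fun ω (k : Fin n) => Z (-((k : ℕ) : ℤ) - 1) ω)

/-- The entropy rate `H(Z) = lim_{n → ∞} H_n(Z)`. -/
noncomputable def entropyRate {Ω : Type*} [MeasurableSpace Ω] {A : ℕ} (P : Measure Ω)
    (Z : ℤ → Ω → Fin A) : ℝ :=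
  limUnder atTop (fun n => entropyApprox P Z n)

/-- `Δ_a`: the matrix `Δ` with the columns `j` such that `Φ j ≠ a` replaced by zero. -/
def symbolMatrix {A B : ℕ} (Φ : Fin B → Fin A) (Δ : Matrix (Fin B) (Fin B) ℝ) (a : Fin A) :
    Matrix (Fin B) (Fin B) ℝ :=
  Matrix.of fun i j => if Φ j = a then Δ i j else 0

/-- The Black Hole condition: every `Δ_a` has rank one, and each of its columns is either
strictly positive or zero. -/
def IsBlackHole {A B : ℕ} (Φ : Fin B → Fin A) (Δ : Matrix (Fin B) (Fin B) ℝ) : Prop :=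
  ∀ a : Fin A, (symbolMatrix Φ Δ a).rank = 1 ∧
    ∀ j, (∀ i, 0 < symbolMatrix Φ Δ a i j) ∨ (∀ i, symbolMatrix Φ Δ a i j = 0)

/-- The mixed partial derivative `∂^N f / ∂ε_{i_1} ⋯ ∂ε_{i_N}` at `x`, where `f` is regarded as a
function on `D` only (so it is a one-sided derivative if `x` is a boundary point of `D`, and the
usual one if `x` is an interior point). -/
noncomputable def mixedPartialWithin {m N : ℕ} (D : Set (Fin m → ℝ)) (i : Fin N → Fin m)
    (f : (Fin m → ℝ) → ℝ) (x : Fin m → ℝ) : ℝ :=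
  iteratedFDerivWithin ℝ N f D x (fun k => Pi.single (i k) 1)

/-! A letter `b` has weight `w_b(x)`, linear in the state vector `x`, and moves `x` to `x T_b /
w_b(x)`. At a Black Hole `T_b` has rank one, so this move forgets `x` altogether; at parameter
distance `d` from the Black Hole the moves contract by a factor `O(d)`
(`IsNearBlackHole.norm_letterStep_sub_le`).

The stationary vector is the average of its successors with weights `w_b`. Hence `H_{n+1} - H_n`
compares an average of the entropy after `n` letters with its value at the barycentre. As the
weights are linear, first order terms cancel and only squares of distances between states survive
(`norm_sum_mul_stateEntropy_sub_le`). Each of the `n` letters shrinks these distances by `O(d)`, so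
`H_{n+1} - H_n` is at most `C₀ (C₁ d²)^n`, and a geometric sum gives `H - H_N = O(d^{2N})`. Since
`2N ≥ N + 1`, all derivatives of order `N` of the difference should vanish.

A real bound alone yields neither smoothness of the limit nor control of its derivatives, so the
argument runs over complex parameters: matrix entries are extended by their power series, the
stationary vector by solving a linear system, and the logarithms are taken in a right half plane.
Uniform convergence on a complex ball makes the limit holomorphic, and Cauchy estimates turn the
bound into vanishing derivatives (`mixedPartialWithin_limUnder_eq`). The link with probability is
`IsStationaryMarkovChain.entropyApprox_eq` together with `sum_letterEntropy_wordVec`. -/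

/-! ### Cauchy estimates and uniform limits in several complex variables -/

section ComplexDifferentiability

/-- A crude Cauchy estimate for the Fréchet derivative. -/
theorem norm_fderiv_le_of_forall_mem_ball_norm_le {E F : Type*} [NormedAddCommGroup E]
    [NormedSpace ℂ E] [NormedAddCommGroup F] [NormedSpace ℂ F] {f : E → F} {c : E} {R M : ℝ}
    (hd : DifferentiableOn ℂ f (Metric.ball c R)) (hR : 0 < R)
    (hM : ∀ y ∈ Metric.ball c R, ‖f y‖ ≤ M) : ‖fderiv ℂ f c‖ ≤ 2 * M / R := by
  -- The Schwarz-type bound needs an image ball centred at `f c`; its radius `2 * M` is the source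
  -- of the factor 2.
  refine Complex.norm_fderiv_le_div_of_mapsTo_ball hd (fun y hy => ?_) hR
  rw [mem_closedBall_iff_norm]
  have h1 := hM y hy
  have h2 := hM c (Metric.mem_ball_self hR)
  linarith [norm_sub_le (f y) (f c)]

/-- Locally uniform limits of holomorphic maps are holomorphic, and the derivatives converge
locally uniformly. -/
theorem differentiableOn_and_tendstoUniformlyOn_fderiv {E F : Type*} [NormedAddCommGroup E]
    [NormedSpace ℂ E] [NormedAddCommGroup F] [NormedSpace ℂ F] [CompleteSpace F] {f : ℕ → E → F}
    {g : E → F} {s : Set E} (hs : IsOpen s) (hf : ∀ n, DifferentiableOn ℂ (f n) s)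
    (hfg : ∀ x ∈ s, ∃ t > 0, TendstoUniformlyOn f g atTop (Metric.ball x t)) :
    DifferentiableOn ℂ g s ∧
      ∀ x ∈ s, ∃ t > 0, TendstoUniformlyOn (fun n => fderiv ℂ (f n)) (fderiv ℂ g) atTop
        (Metric.ball x t) := by
  have key : ∀ x ∈ s, ∃ t > 0, (∀ y ∈ Metric.ball x t, DifferentiableAt ℂ g y) ∧
      TendstoUniformlyOn (fun n => fderiv ℂ (f n)) (fderiv ℂ g) atTop (Metric.ball x t) := by
    intro x hx
    obtain ⟨t₁, ht₁, hsub⟩ := Metric.isOpen_iff.1 hs x hx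
    obtain ⟨t₂, ht₂, hu⟩ := hfg x hx
    -- Halving leaves room for a Cauchy estimate of the same radius `t` around every point of the
    -- ball.
    set t := min t₁ t₂ / 2 with ht
    have htpos : 0 < t := by positivity
    have hball : ∀ y ∈ Metric.ball x t, Metric.ball y t ⊆ s ∩ Metric.ball x t₂ := by
      intro y hy z hz
      have h : dist z x < min t₁ t₂ := by
        rw [Metric.mem_ball] at hy hz
        linarith [dist_triangle z y x]
      exact ⟨hsub (h.trans_le (min_le_left _ _)), h.trans_le (min_le_right _ _)⟩
    have hdiff : ∀ n, ∀ y ∈ Metric.ball x t, DifferentiableAt ℂ (f n) y := fun n y hy =>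
      (hf n).differentiableAt
        (hs.mem_nhds (hball y hy (Metric.mem_ball_self htpos)).1)
    have hcau : UniformCauchySeqOn (fun n => fderiv ℂ (f n)) atTop (Metric.ball x t) := by
      rw [Metric.uniformCauchySeqOn_iff]
      intro ε hε
      obtain ⟨N, hN⟩ := Metric.uniformCauchySeqOn_iff.1 hu.uniformCauchySeqOn (ε * t / 4)
        (by positivity)
      refine ⟨N, fun m hm n hn y hy => ?_⟩
      rw [dist_eq_norm, ← fderiv_sub (hdiff m y hy) (hdiff n y hy)]
      have hle := norm_fderiv_le_of_forall_mem_ball_norm_le (f := f m - f n) (c := y) (R := t)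
        (M := ε * t / 4)
        (((hf m).sub (hf n)).mono fun z hz => (hball y hy hz).1) htpos fun z hz => by
          rw [Pi.sub_apply, ← dist_eq_norm]
          exact (hN m hm n hn z (hball y hy hz).2).le
      refine hle.trans_lt ?_
      rw [div_lt_iff₀ htpos]
      nlinarith [mul_pos hε htpos]
    have hlim : ∀ y, ∃ L, y ∈ Metric.ball x t →
        Tendsto (fun n => fderiv ℂ (f n) y) atTop (𝓝 L) := by
      intro y
      by_cases hy : y ∈ Metric.ball x t
      · obtain ⟨L, hL⟩ := cauchySeq_tendsto_of_complete (hcau.cauchySeq hy)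
        exact ⟨L, fun _ => hL⟩
      · exact ⟨0, fun h => absurd h hy⟩
    choose L hL using hlim
    have hLu : TendstoUniformlyOn (fun n => fderiv ℂ (f n)) L atTop (Metric.ball x t) :=
      hcau.tendstoUniformlyOn_of_tendsto hL
    have hder : ∀ y ∈ Metric.ball x t, HasFDerivAt g (L y) y := fun y hy =>
      hasFDerivAt_of_tendstoUniformlyOn Metric.isOpen_ball hLu
        (fun n z hz => (hdiff n z hz).hasFDerivAt)
        (fun z hz => hu.tendsto_at (hball z hz (Metric.mem_ball_self htpos)).2) hy
    exact ⟨t, htpos, fun y hy => (hder y hy).differentiableAt,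
      hLu.congr_right fun y hy => (hder y hy).fderiv.symm⟩
  refine ⟨fun x hx => ?_, fun x hx => ?_⟩
  · obtain ⟨t, ht, h, -⟩ := key x hx
    exact (h x (Metric.mem_ball_self ht)).differentiableWithinAt
  · obtain ⟨t, ht, -, h⟩ := key x hx
    exact ⟨t, ht, h⟩

/-- Locally uniform limits of smooth functions of complex variables are smooth. -/
theorem contDiffOn_of_tendstoUniformlyOn_ball.{u} {E : Type u} [NormedAddCommGroup E]
    [NormedSpace ℂ E] {s : Set E} (hs : IsOpen s) (k : ℕ) :
    ∀ {F : Type u} [NormedAddCommGroup F] [NormedSpace ℂ F] [CompleteSpace F] {f : ℕ → E → F}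
      {g : E → F}, (∀ n, ContDiffOn ℂ k (f n) s) →
      (∀ x ∈ s, ∃ t > 0, TendstoUniformlyOn f g atTop (Metric.ball x t)) →
      ContDiffOn ℂ k g s := by
  -- The codomain stays general because the step passes from `F` to `E →L[ℂ] F`; sharing the
  -- universe of `E` keeps that space in range.
  induction k with
  | zero =>
    intro F _ _ _ f g hf hfg
    have hloc : TendstoLocallyUniformlyOn f g atTop s :=
      tendstoLocallyUniformlyOn_of_forall_exists_nhds fun x hx => by
        obtain ⟨t, ht, h⟩ := hfg x hx
        exact ⟨Metric.ball x t, mem_nhdsWithin_of_mem_nhds (Metric.ball_mem_nhds x ht), h⟩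
    simp only [Nat.cast_zero, contDiffOn_zero] at hf ⊢
    exact hloc.continuousOn (Frequently.of_forall hf)
  | succ k ih =>
    intro F _ _ _ f g hf hfg
    simp only [Nat.cast_add, Nat.cast_one, contDiffOn_succ_iff_fderiv_of_isOpen hs] at hf ⊢
    obtain ⟨h1, h2⟩ := differentiableOn_and_tendstoUniformlyOn_fderiv hs (fun n => (hf n).1) hfg
    exact ⟨h1, fun h => absurd h (by simp), ih (fun n => (hf n).2.2) h2⟩

/-- A smooth function of complex variables that is `O(‖y - x‖ ^ (k + 1))` has vanishing `k`-th
derivative at `x`. -/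
theorem iteratedFDeriv_eq_zero_of_norm_le_pow.{u} {E : Type u} [NormedAddCommGroup E]
    [NormedSpace ℂ E] {x : E} (k : ℕ) :
    ∀ {F : Type u} [NormedAddCommGroup F] [NormedSpace ℂ F] {f : E → F} {R C : ℝ}, 0 < R →
      ContDiffOn ℂ k f (Metric.ball x R) →
      (∀ y ∈ Metric.ball x R, ‖f y‖ ≤ C * ‖y - x‖ ^ (k + 1)) →
      iteratedFDeriv ℂ k f x = 0 := by
  induction k with
  | zero =>
    intro F _ _ f R C hR _ hC
    have h := hC x (Metric.mem_ball_self hR)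
    have hx : f x = 0 := by simpa using h
    ext m
    simp [hx]
  | succ k ih =>
    intro F _ _ f R C hR hf hC
    have hf' := hf
    simp only [Nat.cast_add, Nat.cast_one,
      contDiffOn_succ_iff_fderiv_of_isOpen Metric.isOpen_ball] at hf'
    have hC0 : 0 ≤ max C 0 := le_max_right _ _
    -- Cauchy estimate on the ball of radius `t` about `y`, where `‖z - x‖ ≤ 2 * t`. The choice `t =
    -- ‖y - x‖` lowers the order of vanishing by one; at `y = x` this radius degenerates and `t → 0`
    -- is used instead.
    have hbound : ∀ y ∈ Metric.ball x (R / 2), ∀ t, 0 < t → ‖y - x‖ ≤ t → t < R / 2 →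
        ‖fderiv ℂ f y‖ ≤ (2 * (max C 0 * 2 ^ (k + 2))) * t ^ (k + 1) := by
      intro y hy t ht hyt htR
      rw [mem_ball_iff_norm] at hy
      have hsub : Metric.ball y t ⊆ Metric.ball x R := fun z hz => by
        rw [mem_ball_iff_norm] at hz ⊢
        have : z - x = (z - y) + (y - x) := by abel
        rw [this]
        linarith [norm_add_le (z - y) (y - x)]
      have := norm_fderiv_le_of_forall_mem_ball_norm_le (f := f) (c := y) (R := t)
        (M := max C 0 * (2 * t) ^ (k + 2)) (hf'.1.mono hsub) ht fun z hz => by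
          refine (hC z (hsub hz)).trans ?_
          rw [mem_ball_iff_norm] at hz
          have h1 : ‖z - x‖ ≤ 2 * t := by
            have : z - x = (z - y) + (y - x) := by abel
            rw [this]
            linarith [norm_add_le (z - y) (y - x)]
          exact mul_le_mul (le_max_left _ _) (pow_le_pow_left₀ (norm_nonneg _) h1 _)
            (by positivity) hC0
      refine this.trans (le_of_eq ?_)
      field_simp
      ring
    have hzero : fderiv ℂ f x = 0 := by
      have hlim : Tendsto (fun t : ℝ => (2 * (max C 0 * 2 ^ (k + 2))) * t ^ (k + 1)) (𝓝[>] 0)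
          (𝓝 0) := by
        have : Tendsto (fun t : ℝ => (2 * (max C 0 * 2 ^ (k + 2))) * t ^ (k + 1)) (𝓝 0)
            (𝓝 ((2 * (max C 0 * 2 ^ (k + 2))) * 0 ^ (k + 1))) :=
          (continuous_const.mul (continuous_pow _)).tendsto _
        rw [zero_pow (Nat.succ_ne_zero k), mul_zero] at this
        exact this.mono_left nhdsWithin_le_nhds
      have : ‖fderiv ℂ f x‖ ≤ 0 := by
        refine ge_of_tendsto hlim ?_
        filter_upwards [Ioo_mem_nhdsGT (show (0 : ℝ) < R / 2 by positivity)] with t ht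
        exact hbound x (Metric.mem_ball_self (by positivity)) t ht.1 (by simpa using ht.1.le) ht.2
      simpa using this
    have hzero' : iteratedFDeriv ℂ k (fderiv ℂ f) x = 0 := by
      refine ih (R := R / 2) (C := 2 * (max C 0 * 2 ^ (k + 2))) (by positivity)
        (hf'.2.2.mono (Metric.ball_subset_ball (half_le_self hR.le))) fun y hy => ?_
      rcases eq_or_ne y x with rfl | hne
      · simp [hzero]
      · exact hbound y hy _ (norm_pos_iff.2 (sub_ne_zero.2 hne)) le_rfl
          (mem_ball_iff_norm.1 hy)
    rw [← norm_eq_zero, ← norm_iteratedFDeriv_fderiv, hzero', norm_zero]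

end ComplexDifferentiability

/-! ### Passage between real and complex variables -/

section Complexification

/-- The coordinatewise inclusion of `ℝᵐ` into `ℂᵐ`. -/
noncomputable def ofRealPi (m : ℕ) : (Fin m → ℝ) →L[ℝ] (Fin m → ℂ) :=
  ContinuousLinearMap.pi fun i => Complex.ofRealCLM.comp (ContinuousLinearMap.proj i)

@[simp]
theorem ofRealPi_apply {m : ℕ} (x : Fin m → ℝ) (i : Fin m) : ofRealPi m x i = (x i : ℂ) := rfl

theorem norm_ofRealPi {m : ℕ} (x : Fin m → ℝ) : ‖ofRealPi m x‖ = ‖x‖ := by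
  simp only [Pi.norm_def]
  congr 2
  ext i
  simp

/-- A real analytic function on a subset of `ℝᵐ` extends locally to a smooth function of complex
variables. -/
theorem AnalyticWithinAt.exists_complex_extension {m : ℕ} {D : Set (Fin m → ℝ)}
    {f : (Fin m → ℝ) → ℝ} {x₀ : Fin m → ℝ} (hf : AnalyticWithinAt ℝ f D x₀) :
    ∃ F : (Fin m → ℂ) → ℂ, ∃ R > 0,
      (∀ k : ℕ, ContDiffOn ℂ k F (Metric.ball (ofRealPi m x₀) R)) ∧
      ∀ x ∈ D, dist x x₀ < R → F (ofRealPi m x) = f x := by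
  obtain ⟨p, r, hp⟩ := hf
  obtain ⟨ρ, hρ0, hρr⟩ := ENNReal.lt_iff_exists_nnreal_btwn.1 hp.r_pos
  have hρ : 0 < (ρ : ℝ) := by exact_mod_cast hρ0
  obtain ⟨C, hC, hpC⟩ := p.norm_mul_pow_le_of_lt_radius (hρr.trans_le hp.r_le)
  -- The term of degree `k` has `m ^ k` monomials, so `m * R ≤ ρ / 2` is what makes the series
  -- geometric; `m + 1` covers `m = 0`.
  set R : ℝ := ρ / (2 * (m + 1)) with hR
  have hRpos : 0 < R := by positivity
  have hRρ : R ≤ ρ := div_le_self hρ.le (by linarith [(Nat.cast_nonneg m : (0 : ℝ) ≤ m)])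
  have hmR : m * R ≤ ρ * (1 / 2) := by
    rw [hR, mul_div_assoc', div_le_iff₀ (by positivity)]
    nlinarith
  let e : Fin m → (Fin m → ℝ) := fun i => Pi.single i 1
  have hene : ∀ i, ‖e i‖ ≤ 1 := fun i => by
    rw [pi_norm_le_iff_of_nonneg zero_le_one]
    intro j
    by_cases h : j = i
    · subst h; simp [e]
    · simp [e, h]
  -- The homogeneous terms are written out in the standard basis so that complex arguments can be
  -- inserted.
  let T : ℕ → (Fin m → ℂ) → ℂ := fun k z =>
    ∑ i : Fin k → Fin m, (p k (fun j => e (i j)) : ℂ) * ∏ j, (z (i j) - ofRealPi m x₀ (i j))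
  have hT : ∀ k, ∀ z ∈ Metric.ball (ofRealPi m x₀) R, ‖T k z‖ ≤ C * (1 / 2) ^ k := by
    intro k z hz
    rw [mem_ball_iff_norm] at hz
    have hterm : ∀ i : Fin k → Fin m,
        ‖(p k (fun j => e (i j)) : ℂ) * ∏ j, (z (i j) - ofRealPi m x₀ (i j))‖ ≤ ‖p k‖ * R ^ k := by
      intro i
      rw [norm_mul, Complex.norm_real, norm_prod]
      refine mul_le_mul ?_ ?_ (by positivity) (norm_nonneg _)
      · refine ((p k).le_opNorm _).trans (mul_le_of_le_one_right (norm_nonneg _) ?_)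
        exact Finset.prod_le_one (fun _ _ => norm_nonneg _) fun _ _ => hene _
      · refine (Finset.prod_le_prod (fun _ _ => norm_nonneg _)
          (fun j _ => ((norm_le_pi_norm (z - ofRealPi m x₀) (i j)).trans hz.le :))).trans ?_
        simp
    calc ‖T k z‖ ≤ ∑ _i : Fin k → Fin m, ‖p k‖ * R ^ k :=
          (norm_sum_le _ _).trans (Finset.sum_le_sum fun i _ => hterm i)
      _ = ‖p k‖ * (m * R) ^ k := by simp; ring
      _ ≤ ‖p k‖ * (ρ * (1 / 2)) ^ k := by gcongr
      _ = ‖p k‖ * ρ ^ k * (1 / 2) ^ k := by ring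
      _ ≤ C * (1 / 2) ^ k := by gcongr; exact hpC k
  have hunif := tendstoUniformlyOn_tsum_nat
    ((summable_geometric_of_lt_one (by norm_num) (by norm_num : (1 / 2 : ℝ) < 1)).mul_left C) hT
  refine ⟨fun z => ∑' k, T k z, R, hRpos, fun k => ?_, fun x hx hxR => ?_⟩
  · refine contDiffOn_of_tendstoUniformlyOn_ball Metric.isOpen_ball k
      (f := fun n z => ∑ k ∈ Finset.range n, T k z) (fun n => ?_) fun x hx => ?_
    · refine ContDiff.contDiffOn ?_
      refine ContDiff.sum fun k _ => ContDiff.sum fun i _ => contDiff_const.mul ?_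
      exact contDiff_prod fun j _ => (contDiff_apply ℂ ℂ (i j)).sub contDiff_const
    · obtain ⟨t, ht, hsub⟩ := Metric.isOpen_iff.1 Metric.isOpen_ball x hx
      exact ⟨t, ht, hunif.mono hsub⟩
  · have hTreal : ∀ k, T k (ofRealPi m x) = ((p k fun _ => x - x₀ : ℝ) : ℂ) := by
      intro k
      have hy : x - x₀ = ∑ i, (x - x₀) i • e i := by
        ext j
        simp [e, Finset.sum_apply, Pi.single_apply]
      have : (p k fun _ => x - x₀) =
          ∑ i : Fin k → Fin m, (∏ j, (x - x₀) (i j)) * p k (fun j => e (i j)) := by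
        conv_lhs => rw [hy]
        rw [ContinuousMultilinearMap.map_sum]
        refine Finset.sum_congr rfl fun i _ => ?_
        rw [ContinuousMultilinearMap.map_smul_univ, smul_eq_mul]
      rw [this]
      push_cast
      refine Finset.sum_congr rfl fun i _ => ?_
      rw [mul_comm]
      congr 1
      refine Finset.prod_congr rfl fun j _ => ?_
      simp
    have hs := hp.hasSum (y := x - x₀) (by simp [hx]) (by
      rw [Metric.mem_eball, edist_dist, dist_zero_right, ← dist_eq_norm]
      refine lt_trans ?_ hρr
      rw [← ENNReal.ofReal_coe_nnreal]
      exact (ENNReal.ofReal_lt_ofReal_iff hρ).2 (hxR.trans_le hRρ))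
    rw [add_sub_cancel] at hs
    simp only [hTreal]
    exact (Complex.hasSum_ofReal.2 hs).tsum_eq

/-- If a smooth function `G` of complex variables is `O(‖z - z₀‖ ^ (N + 1))`, then the partial
derivatives of order `N` of its restriction to real arguments vanish. -/
theorem iteratedFDeriv_re_comp_ofRealPi_eq_zero {m N : ℕ} {G : (Fin m → ℂ) → ℂ}
    {x₀ : Fin m → ℝ} {R C : ℝ} (hR : 0 < R)
    (hG : ContDiffOn ℂ N G (Metric.ball (ofRealPi m x₀) R))
    (hC : ∀ z ∈ Metric.ball (ofRealPi m x₀) R, ‖G z‖ ≤ C * ‖z - ofRealPi m x₀‖ ^ (N + 1)) :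
    iteratedFDeriv ℝ N (fun x => (G (ofRealPi m x)).re) x₀ = 0 := by
  have hnhds : Metric.ball (ofRealPi m x₀) R ∈ 𝓝 (ofRealPi m x₀) := Metric.ball_mem_nhds _ hR
  have hat : ContDiffAt ℂ N G (ofRealPi m x₀) := hG.contDiffAt hnhds
  have h0 : iteratedFDeriv ℝ N G (ofRealPi m x₀) = 0 := by
    rw [← hat.restrictScalars_iteratedFDeriv, Function.comp_apply,
      iteratedFDeriv_eq_zero_of_norm_le_pow N hR hG hC]
    rfl
  have hopen : IsOpen (ofRealPi m ⁻¹' Metric.ball (ofRealPi m x₀) R) :=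
    Metric.isOpen_ball.preimage (ofRealPi m).continuous
  have hGR : ContDiffOn ℝ N G (Metric.ball (ofRealPi m x₀) R) := hG.restrict_scalars ℝ
  have hmem : ofRealPi m x₀ ∈ Metric.ball (ofRealPi m x₀) R := Metric.mem_ball_self hR
  have hcomp : iteratedFDeriv ℝ N (G ∘ ofRealPi m) x₀ = 0 := by
    rw [← iteratedFDerivWithin_of_isOpen N hopen hmem,
      (ofRealPi m).iteratedFDerivWithin_comp_right hGR Metric.isOpen_ball.uniqueDiffOn
        hopen.uniqueDiffOn hmem le_rfl,
      iteratedFDerivWithin_of_isOpen N Metric.isOpen_ball hmem, h0]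
    ext v
    simp
  have hatR : ContDiffAt ℝ N (G ∘ ofRealPi m) x₀ :=
    (hat.restrict_scalars ℝ).comp x₀ (ofRealPi m).contDiff.contDiffAt
  have := Complex.reCLM.iteratedFDeriv_comp_left hatR (i := N) le_rfl
  rw [hcomp] at this
  have h2 : (fun x => (G (ofRealPi m x)).re) = Complex.reCLM ∘ (G ∘ ofRealPi m) := rfl
  rw [h2, this]
  ext v
  simp

end Complexification

/-! ### Entropy of a state vector and its second order estimate -/

section EntropyRecursion

/-- The total mass of the row vector `x` after the letter `b` is emitted. -/
noncomputable def letterWeight {A B : ℕ} (T : Fin A → Matrix (Fin B) (Fin B) ℂ) (b : Fin A)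
    (x : Fin B → ℂ) : ℂ :=
  ∑ i, x i * ∑ j, T b i j

/-- The normalised state vector after the letter `b` is emitted. -/
noncomputable def letterStep {A B : ℕ} (T : Fin A → Matrix (Fin B) (Fin B) ℂ) (b : Fin A)
    (x : Fin B → ℂ) : Fin B → ℂ :=
  (letterWeight T b x)⁻¹ • Matrix.vecMul x (T b)

/-- The conditional entropy of the next letter given `n` letters, when the hidden chain is started
from the normalised state vector `x`. -/
noncomputable def stateEntropy {A B : ℕ} (T : Fin A → Matrix (Fin B) (Fin B) ℂ) :
    ℕ → (Fin B → ℂ) → ℂ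
  | 0, x => -∑ b, letterWeight T b x * Complex.log (letterWeight T b x)
  | n + 1, x => ∑ b, letterWeight T b x * stateEntropy T n (letterStep T b x)

theorem letterWeight_eq_sum_vecMul {A B : ℕ} (T : Fin A → Matrix (Fin B) (Fin B) ℂ) (b : Fin A)
    (x : Fin B → ℂ) : letterWeight T b x = ∑ j, Matrix.vecMul x (T b) j := by
  simp only [letterWeight, Matrix.vecMul, dotProduct, Finset.mul_sum]
  exact Finset.sum_comm

theorem letterWeight_sub {A B : ℕ} (T : Fin A → Matrix (Fin B) (Fin B) ℂ) (b : Fin A)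
    (x y : Fin B → ℂ) : letterWeight T b (x - y) = letterWeight T b x - letterWeight T b y := by
  simp only [letterWeight, Pi.sub_apply, sub_mul, Finset.sum_sub_distrib]

theorem letterWeight_smul {A B : ℕ} (T : Fin A → Matrix (Fin B) (Fin B) ℂ) (b : Fin A)
    (s : ℂ) (x : Fin B → ℂ) : letterWeight T b (s • x) = s * letterWeight T b x := by
  simp only [letterWeight, Pi.smul_apply, smul_eq_mul, Finset.mul_sum, mul_assoc]

theorem letterWeight_sum {A B : ℕ} {ι : Type*} [Fintype ι]
    (T : Fin A → Matrix (Fin B) (Fin B) ℂ) (b : Fin A) (x : ι → Fin B → ℂ) :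
    letterWeight T b (∑ a, x a) = ∑ a, letterWeight T b (x a) := by
  simp only [letterWeight, Finset.sum_apply, Finset.sum_mul]
  exact Finset.sum_comm

/-- Second order Taylor estimate for `q log q` on a half plane. -/
theorem norm_mul_log_sub_le {c : ℝ} (hc : 0 < c) {q q' : ℂ} (hq : c ≤ q.re) (hq' : c ≤ q'.re) :
    ‖q' * Complex.log q' - q * Complex.log q - (Complex.log q + 1) * (q' - q)‖ ≤
      ‖q' - q‖ ^ 2 / c := by
  have hslit : ∀ t ∈ segment ℝ q q', t ∈ Complex.slitPlane ∧ c ≤ ‖t‖ := by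
    intro t ht
    have hre : c ≤ t.re := by
      have hconv : Convex ℝ {z : ℂ | c ≤ z.re} := convex_halfSpace_re_ge c
      exact hconv.segment_subset hq hq' ht
    exact ⟨Or.inl (hc.trans_le hre), hre.trans (Complex.re_le_norm t)⟩
  have hnorm : ∀ t ∈ segment ℝ q q', ‖t - q‖ ≤ ‖q' - q‖ := fun t ht => by
    obtain ⟨a, b, ha, hb, hab, rfl⟩ := ht
    have : a • q + b • q' - q = b • (q' - q) := by
      have : a = 1 - b := by linarith
      subst this
      simp only [Complex.real_smul]
      push_cast
      ring
    rw [this, norm_smul, Real.norm_of_nonneg hb]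
    exact mul_le_of_le_one_left (norm_nonneg _) (by linarith)
  -- The mean value inequality is used twice: here for `log`, then for `z log z` minus its linear
  -- part at `q`, whose derivative is `log z - log q`.
  have hlog : ∀ t ∈ segment ℝ q q', ‖Complex.log t - Complex.log q‖ ≤ ‖q' - q‖ / c := by
    intro t ht
    have h := Convex.norm_image_sub_le_of_norm_hasDerivWithin_le (𝕜 := ℂ) (f := Complex.log)
      (f' := fun z => z⁻¹) (s := segment ℝ q q') (C := c⁻¹)
      (fun z hz => (Complex.hasDerivAt_log (hslit z hz).1).hasDerivWithinAt)
      (fun z hz => by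
        rw [norm_inv]
        exact inv_anti₀ hc (hslit z hz).2)
      (convex_segment q q') (left_mem_segment ℝ q q') ht
    refine h.trans ?_
    rw [inv_mul_eq_div]
    exact div_le_div_of_nonneg_right (hnorm t ht) hc.le
  have h := Convex.norm_image_sub_le_of_norm_hasDerivWithin_le (𝕜 := ℂ)
    (f := fun z => z * Complex.log z - (Complex.log q + 1) * z)
    (f' := fun z => Complex.log z - Complex.log q) (s := segment ℝ q q') (C := ‖q' - q‖ / c)
    (fun z hz => by
      have hz0 : z ≠ 0 := Complex.slitPlane_ne_zero (hslit z hz).1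
      have h1 := ((hasDerivAt_id z).mul (Complex.hasDerivAt_log (hslit z hz).1)).sub
        ((hasDerivAt_id z).const_mul (Complex.log q + 1))
      refine (h1.congr_deriv ?_).hasDerivWithinAt
      simp only [id, mul_inv_cancel₀ hz0]
      ring)
    hlog (convex_segment q q') (left_mem_segment ℝ q q') (right_mem_segment ℝ q q')
  calc _ = ‖q' * Complex.log q' - (Complex.log q + 1) * q' -
        (q * Complex.log q - (Complex.log q + 1) * q)‖ := by congr 1; ring
    _ ≤ _ := h
    _ = _ := by ring

/-- If the letter maps contract by the factor `l` on `K`, the entropies of mixtures of close states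
are nearly the mixtures of the entropies. -/
theorem norm_sum_mul_stateEntropy_sub_le {A B : ℕ} {T : Fin A → Matrix (Fin B) (Fin B) ℂ}
    {K : Set (Fin B → ℂ)} {c R S l : ℝ} (hc : 0 < c) (hR : 0 ≤ R)
    (hre : ∀ b, ∀ x ∈ K, c ≤ (letterWeight T b x).re)
    (hnorm : ∀ b, ∀ x ∈ K, ‖letterWeight T b x‖ ≤ R)
    (hstep : ∀ b, ∀ x ∈ K, letterStep T b x ∈ K)
    (hweight : ∀ b x y, ‖letterWeight T b x - letterWeight T b y‖ ≤ S * ‖x - y‖)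
    (hlip : ∀ b, ∀ x ∈ K, ∀ y ∈ K, ‖letterStep T b x - letterStep T b y‖ ≤ l * ‖x - y‖)
    {ι : Type*} [Fintype ι] (n : ℕ) :
    ∀ {x : Fin B → ℂ} {s : ℂ} {xs : ι → Fin B → ℂ} {ss : ι → ℂ} {δ : ℝ}, x ∈ K →
      (∀ a, xs a ∈ K) → ∑ a, ss a = s → ∑ a, ss a • xs a = s • x → (∀ a, ‖xs a - x‖ ≤ δ) →
      ‖∑ a, ss a * stateEntropy T n (xs a) - s * stateEntropy T n x‖ ≤
        A * (S ^ 2 / c) * (A * R * l ^ 2) ^ n * (∑ a, ‖ss a‖) * δ ^ 2 := by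
  induction n with
  | zero =>
    intro x s xs ss δ hx hxs hs hsx hδ
    simp only [stateEntropy]
    -- First order Taylor terms cancel: the weights are linear and `x` is the barycentre of the `xs
    -- a`.
    have hlin : ∀ b, ∑ a, ss a * (letterWeight T b (xs a) - letterWeight T b x) = 0 := by
      intro b
      have := congrArg (letterWeight T b) hsx
      simp only [letterWeight_sum, letterWeight_smul] at this
      simp only [mul_sub, Finset.sum_sub_distrib, this, ← Finset.sum_mul, hs, sub_self]
    let ψ : ℂ → ℂ := fun q => q * Complex.log q
    let d : Fin A → ι → ℂ := fun b a => ψ (letterWeight T b (xs a)) - ψ (letterWeight T b x) -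
      (Complex.log (letterWeight T b x) + 1) * (letterWeight T b (xs a) - letterWeight T b x)
    have heq : ∑ a, ss a * -∑ b, ψ (letterWeight T b (xs a)) - s * -∑ b, ψ (letterWeight T b x) =
        -∑ b, ∑ a, ss a * d b a := by
      have h1 : ∀ b, ∑ a, ss a * d b a =
          ∑ a, ss a * ψ (letterWeight T b (xs a)) - s * ψ (letterWeight T b x) := by
        intro b
        have h2 : ∀ a, ss a * d b a = ss a * ψ (letterWeight T b (xs a)) -
            ss a * ψ (letterWeight T b x) - (Complex.log (letterWeight T b x) + 1) *
              (ss a * (letterWeight T b (xs a) - letterWeight T b x)) := fun a => by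
          simp only [d]; ring
        simp only [h2, Finset.sum_sub_distrib, ← Finset.mul_sum, hlin b, ← Finset.sum_mul, hs]
        ring
      simp only [h1, Finset.sum_sub_distrib, Finset.mul_sum, mul_neg, Finset.sum_neg_distrib]
      rw [Finset.sum_comm]
      ring
    refine (le_of_eq (congrArg norm heq)).trans ?_
    rw [norm_neg]
    have hd : ∀ b a, ‖d b a‖ ≤ S ^ 2 / c * δ ^ 2 := by
      intro b a
      refine (norm_mul_log_sub_le hc (hre b x hx) (hre b _ (hxs a))).trans ?_
      have h1 : ‖letterWeight T b (xs a) - letterWeight T b x‖ ^ 2 ≤ (S * ‖xs a - x‖) ^ 2 :=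
        pow_le_pow_left₀ (norm_nonneg _) (hweight b _ _) 2
      have h2 : ‖xs a - x‖ ^ 2 ≤ δ ^ 2 := pow_le_pow_left₀ (norm_nonneg _) (hδ a) 2
      calc _ ≤ (S * ‖xs a - x‖) ^ 2 / c := by gcongr
        _ = S ^ 2 / c * ‖xs a - x‖ ^ 2 := by ring
        _ ≤ _ := by gcongr
    calc ‖∑ b, ∑ a, ss a * d b a‖ ≤ ∑ _b : Fin A, ∑ a, ‖ss a‖ * (S ^ 2 / c * δ ^ 2) := by
          refine (norm_sum_le _ _).trans (Finset.sum_le_sum fun b _ => ?_)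
          refine (norm_sum_le _ _).trans (Finset.sum_le_sum fun a _ => ?_)
          rw [norm_mul]
          gcongr
          exact hd b a
      _ = _ := by
          rw [Finset.sum_const, ← Finset.sum_mul, Finset.card_univ, Fintype.card_fin, nsmul_eq_mul]
          ring
  | succ n ih =>
    intro x s xs ss δ hx hxs hs hsx hδ
    simp only [stateEntropy]
    -- For each letter the successors form a new mixture with barycentre `letterStep T b x`. Its
    -- diameter shrinks by `l`, its mass grows at most by `R`, and there are `A` letters: hence the
    -- factor `A * R * l ^ 2`. The sign of `l` is unknown, which explains `|l|`.
    have hl0 : ∀ a : ι, ∀ b, ‖letterStep T b (xs a) - letterStep T b x‖ ≤ |l| * δ := fun a b =>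
      (hlip b _ (hxs a) _ hx).trans (mul_le_mul (le_abs_self l) (hδ a) (norm_nonneg _)
        (abs_nonneg l))
    have hmul : ∀ b, ∀ y ∈ K, letterWeight T b y • letterStep T b y = Matrix.vecMul y (T b) := by
      intro b y hy
      have hne : letterWeight T b y ≠ 0 := fun h => by
        have := hre b y hy
        rw [h, Complex.zero_re] at this
        linarith
      rw [letterStep, smul_smul, mul_inv_cancel₀ hne, one_smul]
    have hb : ∀ b, ‖∑ a, (ss a * letterWeight T b (xs a)) * stateEntropy T n (letterStep T b (xs a))
        - (s * letterWeight T b x) * stateEntropy T n (letterStep T b x)‖ ≤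
        A * (S ^ 2 / c) * (A * R * l ^ 2) ^ n * ((∑ a, ‖ss a‖) * R) * (|l| * δ) ^ 2 := by
      intro b
      refine (ih (hstep b x hx) (fun a => hstep b _ (hxs a)) ?_ ?_ fun a => hl0 a b).trans ?_
      · have := congrArg (letterWeight T b) hsx
        simpa only [letterWeight_sum, letterWeight_smul] using this
      · simp only [mul_smul, hmul b _ (hxs _), hmul b _ hx, ← Matrix.smul_vecMul,
          ← Matrix.sum_vecMul, hsx]
      · have : ∑ a, ‖ss a * letterWeight T b (xs a)‖ ≤ (∑ a, ‖ss a‖) * R := by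
          rw [Finset.sum_mul]
          refine Finset.sum_le_sum fun a _ => ?_
          rw [norm_mul]
          gcongr
          exact hnorm b _ (hxs a)
        gcongr
    have heq : ∑ a, ss a * ∑ b, letterWeight T b (xs a) * stateEntropy T n (letterStep T b (xs a))
        - s * ∑ b, letterWeight T b x * stateEntropy T n (letterStep T b x) =
        ∑ b, (∑ a, (ss a * letterWeight T b (xs a)) * stateEntropy T n (letterStep T b (xs a))
        - (s * letterWeight T b x) * stateEntropy T n (letterStep T b x)) := by
      simp only [Finset.sum_sub_distrib, Finset.mul_sum, mul_assoc]
      rw [Finset.sum_comm]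
    rw [heq]
    calc _ ≤ ∑ _b : Fin A,
          A * (S ^ 2 / c) * (A * R * l ^ 2) ^ n * ((∑ a, ‖ss a‖) * R) * (|l| * δ) ^ 2 :=
          (norm_sum_le _ _).trans (Finset.sum_le_sum fun b _ => hb b)
      _ = _ := by
          rw [Finset.sum_const, Finset.card_univ, Fintype.card_fin, nsmul_eq_mul, mul_pow |l| δ, sq_abs]
          ring

/-- Consecutive entropy approximations of a stationary state vector. -/
theorem norm_stateEntropy_succ_sub_le {A B : ℕ} {T : Fin A → Matrix (Fin B) (Fin B) ℂ}
    {K : Set (Fin B → ℂ)} {c R S l δ : ℝ} (hc : 0 < c) (hR : 0 ≤ R)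
    (hre : ∀ b, ∀ x ∈ K, c ≤ (letterWeight T b x).re)
    (hnorm : ∀ b, ∀ x ∈ K, ‖letterWeight T b x‖ ≤ R)
    (hstep : ∀ b, ∀ x ∈ K, letterStep T b x ∈ K)
    (hweight : ∀ b x y, ‖letterWeight T b x - letterWeight T b y‖ ≤ S * ‖x - y‖)
    (hlip : ∀ b, ∀ x ∈ K, ∀ y ∈ K, ‖letterStep T b x - letterStep T b y‖ ≤ l * ‖x - y‖)
    (hdiam : ∀ x ∈ K, ∀ y ∈ K, ‖x - y‖ ≤ δ) {x : Fin B → ℂ} (hx : x ∈ K)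
    (hsum : ∑ i, x i = 1) (hstat : ∑ b, Matrix.vecMul x (T b) = x) (n : ℕ) :
    ‖stateEntropy T (n + 1) x - stateEntropy T n x‖ ≤
      A * (S ^ 2 / c) * (A * R) * δ ^ 2 * (A * R * l ^ 2) ^ n := by
  have hne : ∀ b, letterWeight T b x ≠ 0 := fun b h => by
    have := hre b x hx
    rw [h, Complex.zero_re] at this
    linarith
  -- Stationarity exhibits `x` as the mixture of its own successors, and the recursion for `n + 1`
  -- is the corresponding mixture of entropies.
  have h := norm_sum_mul_stateEntropy_sub_le hc hR hre hnorm hstep hweight hlip n (x := x) (s := 1)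
    (xs := fun b => letterStep T b x) (ss := fun b => letterWeight T b x) (δ := δ) hx
    (fun b => hstep b x hx) (by
      simp only [letterWeight_eq_sum_vecMul]
      rw [Finset.sum_comm]
      simp only [← Finset.sum_apply, hstat, hsum]) (by
      simp only [letterStep, smul_smul, mul_inv_cancel₀ (hne _), one_smul, hstat])
    (fun b => hdiam _ (hstep b x hx) _ hx)
  rw [one_mul] at h
  refine h.trans ?_
  have hsum' : ∑ b : Fin A, ‖letterWeight T b x‖ ≤ A * R := by
    refine (Finset.sum_le_sum fun b _ => hnorm b x hx).trans ?_
    simp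
  calc _ ≤ A * (S ^ 2 / c) * (A * R * l ^ 2) ^ n * (A * R) * δ ^ 2 := by gcongr
    _ = _ := by ring

end EntropyRecursion

/-! ### Contraction of the letter maps near a Black Hole -/

section Perturbation

/-- The complex vectors that are close to a probability vector. -/
def nearStdSimplex (B : ℕ) (η : ℝ) : Set (Fin B → ℂ) :=
  {x | ∃ p ∈ stdSimplex ℝ (Fin B), ∀ i, ‖x i - p i‖ ≤ η}

/-- The letter matrices `T` are entrywise `τ`-close to nonnegative substochastic letter matrices
`T₀` that satisfy the rank one condition, and whose row sums are bounded below by `c`. -/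
structure IsNearBlackHole {A B : ℕ} (T : Fin A → Matrix (Fin B) (Fin B) ℂ)
    (T₀ : Fin A → Matrix (Fin B) (Fin B) ℝ) (c τ : ℝ) : Prop where
  nonneg : ∀ b i j, 0 ≤ T₀ b i j
  rowSum_le : ∀ b i, ∑ j, T₀ b i j ≤ 1
  le_rowSum : ∀ b i, c ≤ ∑ j, T₀ b i j
  minor : ∀ b i j k, T₀ b i j * ∑ l, T₀ b k l = T₀ b k j * ∑ l, T₀ b i l
  dist_le : ∀ b i j, ‖T b i j - T₀ b i j‖ ≤ τ

namespace IsNearBlackHole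

variable {A B : ℕ} {T : Fin A → Matrix (Fin B) (Fin B) ℂ}
  {T₀ : Fin A → Matrix (Fin B) (Fin B) ℝ} {c τ η : ℝ}

theorem rowSum_dist_le (h : IsNearBlackHole T T₀ c τ) (b : Fin A) (i : Fin B) :
    ‖∑ j, T b i j - ((∑ j, T₀ b i j : ℝ) : ℂ)‖ ≤ B * τ := by
  push_cast
  rw [← Finset.sum_sub_distrib]
  refine (norm_sum_le _ _).trans ((Finset.sum_le_sum fun j _ => h.dist_le b i j).trans ?_)
  simp

theorem entry_le_one (h : IsNearBlackHole T T₀ c τ) (b : Fin A) (i j : Fin B) : T₀ b i j ≤ 1 :=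
  (Finset.single_le_sum (fun j _ => h.nonneg b i j) (Finset.mem_univ j)).trans (h.rowSum_le b i)

theorem rowSum_nonneg (h : IsNearBlackHole T T₀ c τ) (b : Fin A) (i : Fin B) :
    0 ≤ ∑ j, T₀ b i j := Finset.sum_nonneg fun j _ => h.nonneg b i j

theorem norm_rowSum_le (h : IsNearBlackHole T T₀ c τ) (hτ : B * τ ≤ 1) (b : Fin A) (i : Fin B) :
    ‖∑ j, T b i j‖ ≤ 2 := by
  have h1 := norm_le_norm_add_norm_sub' (∑ j, T b i j) ((∑ j, T₀ b i j : ℝ) : ℂ)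
  have h2 := h.rowSum_dist_le b i
  rw [Complex.norm_real, Real.norm_of_nonneg (h.rowSum_nonneg b i)] at h1
  linarith [h.rowSum_le b i]

theorem norm_letterWeight_sub_le (h : IsNearBlackHole T T₀ c τ) (hτ : B * τ ≤ 1) (b : Fin A)
    (x y : Fin B → ℂ) : ‖letterWeight T b x - letterWeight T b y‖ ≤ 2 * B * ‖x - y‖ := by
  rw [← letterWeight_sub, letterWeight]
  refine (norm_sum_le _ _).trans ?_
  calc _ ≤ ∑ _i : Fin B, ‖x - y‖ * 2 := Finset.sum_le_sum fun i _ => by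
        rw [norm_mul]
        exact mul_le_mul (norm_le_pi_norm (x - y) i) (h.norm_rowSum_le hτ b i) (norm_nonneg _)
          (norm_nonneg _)
    _ = _ := by simp; ring

theorem norm_apply_le_two (hη : η ≤ 1) {x : Fin B → ℂ} (hx : x ∈ nearStdSimplex B η)
    (i : Fin B) : ‖x i‖ ≤ 2 := by
  obtain ⟨p, hp, hxp⟩ := hx
  have h1 := norm_le_norm_add_norm_sub' (x i) (p i : ℂ)
  have h2 : p i ≤ 1 := (Finset.single_le_sum (fun j _ => hp.1 j) (Finset.mem_univ i)).trans hp.2.le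
  rw [Complex.norm_real, Real.norm_of_nonneg (hp.1 i)] at h1
  linarith [hxp i]

/-- On vectors close to the simplex, the letter weights are close to numbers in `[c, 1]`. -/
theorem exists_norm_letterWeight_sub_le (h : IsNearBlackHole T T₀ c τ) (hη : η ≤ 1)
    (hηc : B * η ≤ c / 4) (hτc : 2 * B ^ 2 * τ ≤ c / 4) {x : Fin B → ℂ}
    (hx : x ∈ nearStdSimplex B η) (b : Fin A) :
    ∃ r : ℝ, c ≤ r ∧ r ≤ 1 ∧ ‖letterWeight T b x - r‖ ≤ c / 2 := by
  obtain ⟨p, hp, hxp⟩ := id hx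
  -- The weight of the unperturbed matrix at the nearby probability vector: a convex combination of
  -- row sums in `[c, 1]`. Replacing `T` and `x` costs `c / 4` each.
  refine ⟨∑ i, p i * ∑ j, T₀ b i j, ?_, ?_, ?_⟩
  · calc c = ∑ i, p i * c := by rw [← Finset.sum_mul, hp.2, one_mul]
      _ ≤ _ := Finset.sum_le_sum fun i _ => mul_le_mul_of_nonneg_left (h.le_rowSum b i) (hp.1 i)
  · calc _ ≤ ∑ i, p i * 1 :=
          Finset.sum_le_sum fun i _ => mul_le_mul_of_nonneg_left (h.rowSum_le b i) (hp.1 i)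
      _ = 1 := by rw [← Finset.sum_mul, hp.2, one_mul]
  · have hterm : ∀ i, ‖x i * ∑ j, T b i j - (p i : ℂ) * ((∑ j, T₀ b i j : ℝ) : ℂ)‖ ≤
        2 * (B * τ) + η := by
      intro i
      have : x i * ∑ j, T b i j - (p i : ℂ) * ((∑ j, T₀ b i j : ℝ) : ℂ) =
          x i * (∑ j, T b i j - ((∑ j, T₀ b i j : ℝ) : ℂ)) +
          (x i - p i) * ((∑ j, T₀ b i j : ℝ) : ℂ) := by ring
      rw [this]
      refine (norm_add_le _ _).trans (add_le_add ?_ ?_)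
      · rw [norm_mul]
        exact mul_le_mul (norm_apply_le_two hη hx i) (h.rowSum_dist_le b i) (norm_nonneg _)
          (by norm_num)
      · rw [norm_mul, Complex.norm_real, Real.norm_of_nonneg (h.rowSum_nonneg b i)]
        exact (mul_le_of_le_one_right (norm_nonneg _) (h.rowSum_le b i)).trans (hxp i)
    have hcast : ((∑ i, p i * ∑ j, T₀ b i j : ℝ) : ℂ) =
        ∑ i, (p i : ℂ) * ((∑ j, T₀ b i j : ℝ) : ℂ) := by push_cast; rfl
    rw [hcast, letterWeight, ← Finset.sum_sub_distrib]
    calc _ ≤ ∑ _i : Fin B, (2 * (B * τ) + η) :=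
          (norm_sum_le _ _).trans (Finset.sum_le_sum fun i _ => hterm i)
      _ = 2 * B ^ 2 * τ + B * η := by simp; ring
      _ ≤ c / 2 := by linarith

theorem le_re_letterWeight (h : IsNearBlackHole T T₀ c τ) (hη : η ≤ 1)
    (hηc : B * η ≤ c / 4) (hτc : 2 * B ^ 2 * τ ≤ c / 4) {x : Fin B → ℂ}
    (hx : x ∈ nearStdSimplex B η) (b : Fin A) : c / 2 ≤ (letterWeight T b x).re := by
  obtain ⟨r, hr, -, hd⟩ := h.exists_norm_letterWeight_sub_le hη hηc hτc hx b
  have h1 := (abs_le.1 ((Complex.abs_re_le_norm _).trans hd)).1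
  rw [Complex.sub_re, Complex.ofReal_re] at h1
  linarith

theorem norm_letterWeight_le_two (h : IsNearBlackHole T T₀ c τ) (hc : c ≤ 1) (hη : η ≤ 1)
    (hηc : B * η ≤ c / 4) (hτc : 2 * B ^ 2 * τ ≤ c / 4) {x : Fin B → ℂ}
    (hx : x ∈ nearStdSimplex B η) (b : Fin A) : ‖letterWeight T b x‖ ≤ 2 := by
  obtain ⟨r, hr, hr1, hd⟩ := h.exists_norm_letterWeight_sub_le hη hηc hτc hx b
  have h1 := norm_le_norm_add_norm_sub' (letterWeight T b x) (r : ℂ)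
  rw [Complex.norm_real] at h1
  have h2 : |r| ≤ 1 := abs_le.2 ⟨by linarith [norm_nonneg (letterWeight T b x - r)], hr1⟩
  rw [Real.norm_eq_abs] at h1
  linarith

/-- For `T₀` itself every state goes to the same probability vector, the common normalised row. The
contributions of `T₀` to the deviation from it cancel, leaving an error of order `τ` over a weight
of modulus at least `c / 2`. -/
theorem letterStep_mem (h : IsNearBlackHole T T₀ c τ) (hc0 : 0 < c) (hη : η ≤ 1)
    (hηc : B * η ≤ c / 4) (hτc : 2 * B ^ 2 * τ ≤ c / 4)
    (hτη : 2 * B * ((1 + B) * τ) ≤ η * (c / 2)) {x : Fin B → ℂ}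
    (hx : x ∈ nearStdSimplex B η) (b : Fin A) : letterStep T b x ∈ nearStdSimplex B η := by
  have hre := h.le_re_letterWeight hη hηc hτc hx b
  have hnorm : c / 2 ≤ ‖letterWeight T b x‖ := hre.trans (Complex.re_le_norm _)
  have hne : letterWeight T b x ≠ 0 := fun h0 => by
    rw [h0, norm_zero] at hnorm
    linarith
  have hi₀ : Nonempty (Fin B) := by
    by_contra hB
    have := not_nonempty_iff.1 hB
    exact hne (by simp [letterWeight])
  obtain ⟨i₀⟩ := hi₀
  have hr₀ : 0 < ∑ j, T₀ b i₀ j := hc0.trans_le (h.le_rowSum b i₀)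
  -- The index `i₀` is arbitrary: by `minor`, every row of `T₀ b` is its row sum times `v`.
  let v : Fin B → ℝ := fun j => T₀ b i₀ j / ∑ l, T₀ b i₀ l
  have hv0 : ∀ j, 0 ≤ v j := fun j => div_nonneg (h.nonneg b i₀ j) hr₀.le
  have hvsum : ∑ j, v j = 1 := by
    simp only [v]
    rw [← Finset.sum_div, div_self hr₀.ne']
  have hv1 : ∀ j, v j ≤ 1 := fun j =>
    (Finset.single_le_sum (fun j _ => hv0 j) (Finset.mem_univ j)).trans hvsum.le
  have hv : ∀ i j, T₀ b i j = v j * ∑ l, T₀ b i l := fun i j => by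
    simp only [v]
    rw [div_mul_eq_mul_div, eq_div_iff hr₀.ne', h.minor]
  refine ⟨v, ⟨hv0, hvsum⟩, fun j => ?_⟩
  have heq : letterStep T b x j - v j = (letterWeight T b x)⁻¹ *
      ∑ i, x i * ((T b i j - T₀ b i j) - v j * (∑ l, T b i l - ((∑ l, T₀ b i l : ℝ) : ℂ))) := by
    have h1 : ∀ i, (T b i j - T₀ b i j) - v j * (∑ l, T b i l - ((∑ l, T₀ b i l : ℝ) : ℂ)) =
        T b i j - v j * ∑ l, T b i l := fun i => by
      rw [hv i j]
      push_cast
      ring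
    simp only [h1]
    simp only [mul_sub, Finset.sum_sub_distrib]
    have h2 : ∑ i, x i * ((v j : ℂ) * ∑ l, T b i l) = v j * letterWeight T b x := by
      rw [letterWeight, Finset.mul_sum]
      exact Finset.sum_congr rfl fun i _ => by ring
    rw [h2, mul_left_comm, inv_mul_cancel₀ hne, mul_one]
    rfl
  have hterm : ∀ i, ‖x i * ((T b i j - T₀ b i j) -
      v j * (∑ l, T b i l - ((∑ l, T₀ b i l : ℝ) : ℂ)))‖ ≤ 2 * ((1 + B) * τ) := by
    intro i
    rw [norm_mul]
    refine mul_le_mul (norm_apply_le_two hη hx i) ?_ (norm_nonneg _) (by norm_num)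
    have h1 : ‖(v j : ℂ) * (∑ l, T b i l - ((∑ l, T₀ b i l : ℝ) : ℂ))‖ ≤ B * τ := by
      rw [norm_mul, Complex.norm_real, Real.norm_of_nonneg (hv0 j)]
      exact (mul_le_of_le_one_left (norm_nonneg _) (hv1 j)).trans (h.rowSum_dist_le b i)
    linarith [norm_sub_le (T b i j - T₀ b i j)
      ((v j : ℂ) * (∑ l, T b i l - ((∑ l, T₀ b i l : ℝ) : ℂ))), h.dist_le b i j]
  rw [heq, norm_mul, norm_inv, inv_mul_le_iff₀ (by linarith)]
  calc _ ≤ ∑ _i : Fin B, 2 * ((1 + B) * τ) :=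
        (norm_sum_le _ _).trans (Finset.sum_le_sum fun i _ => hterm i)
    _ = 2 * B * ((1 + B) * τ) := by simp; ring
    _ ≤ η * (c / 2) := hτη
    _ ≤ η * ‖letterWeight T b x‖ := by
        refine mul_le_mul_of_nonneg_left hnorm ?_
        obtain ⟨p, -, hp⟩ := hx
        exact (norm_nonneg _).trans (hp i₀)
    _ = _ := mul_comm _ _

/-- These minors vanish for `T₀`, and each of the two products moves by at most `(2 + B) * τ`. -/
theorem norm_minor_le (h : IsNearBlackHole T T₀ c τ) (hτ : B * τ ≤ 1) (b : Fin A)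
    (i j k : Fin B) :
    ‖T b i j * ∑ l, T b k l - T b k j * ∑ l, T b i l‖ ≤ 2 * ((2 + B) * τ) := by
  have hterm : ∀ i k, ‖T b i j * ∑ l, T b k l - (T₀ b i j : ℂ) * ((∑ l, T₀ b k l : ℝ) : ℂ)‖ ≤
      (2 + B) * τ := by
    intro i k
    have : T b i j * ∑ l, T b k l - (T₀ b i j : ℂ) * ((∑ l, T₀ b k l : ℝ) : ℂ) =
        (T b i j - T₀ b i j) * ∑ l, T b k l +
        T₀ b i j * (∑ l, T b k l - ((∑ l, T₀ b k l : ℝ) : ℂ)) := by ring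
    rw [this]
    have h1 : ‖(T b i j - T₀ b i j) * ∑ l, T b k l‖ ≤ τ * 2 := by
      rw [norm_mul]
      exact mul_le_mul (h.dist_le b i j) (h.norm_rowSum_le hτ b k) (norm_nonneg _)
        ((norm_nonneg _).trans (h.dist_le b i j))
    have h2 : ‖(T₀ b i j : ℂ) * (∑ l, T b k l - ((∑ l, T₀ b k l : ℝ) : ℂ))‖ ≤ B * τ := by
      rw [norm_mul, Complex.norm_real, Real.norm_of_nonneg (h.nonneg b i j)]
      exact (mul_le_of_le_one_left (norm_nonneg _) (h.entry_le_one b i j)).trans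
        (h.rowSum_dist_le b k)
    linarith [norm_add_le ((T b i j - T₀ b i j) * ∑ l, T b k l)
      ((T₀ b i j : ℂ) * (∑ l, T b k l - ((∑ l, T₀ b k l : ℝ) : ℂ)))]
  have heq : T b i j * ∑ l, T b k l - T b k j * ∑ l, T b i l =
      (T b i j * ∑ l, T b k l - (T₀ b i j : ℂ) * ((∑ l, T₀ b k l : ℝ) : ℂ)) -
      (T b k j * ∑ l, T b i l - (T₀ b k j : ℂ) * ((∑ l, T₀ b i l : ℝ) : ℂ)) := by
    have := h.minor b i j k
    have h' : (T₀ b i j : ℂ) * ((∑ l, T₀ b k l : ℝ) : ℂ) =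
        (T₀ b k j : ℂ) * ((∑ l, T₀ b i l : ℝ) : ℂ) := by exact_mod_cast this
    rw [h']
    ring
  rw [heq]
  linarith [norm_sub_le (T b i j * ∑ l, T b k l - (T₀ b i j : ℂ) * ((∑ l, T₀ b k l : ℝ) : ℂ))
    (T b k j * ∑ l, T b i l - (T₀ b k j : ℂ) * ((∑ l, T₀ b i l : ℝ) : ℂ)), hterm i k, hterm k i]

/-- Over the common denominator, the numerator is bilinear in `x - y` and `y` with the almost
vanishing minors as coefficients. This gives the two factors `τ` and `‖x - y‖`; the denominator is
at least `(c / 2) ^ 2`. -/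
theorem norm_letterStep_sub_le (h : IsNearBlackHole T T₀ c τ) (hc0 : 0 < c) (hη : η ≤ 1)
    (hηc : B * η ≤ c / 4) (hτc : 2 * B ^ 2 * τ ≤ c / 4) (hτ : B * τ ≤ 1) (hτ0 : 0 ≤ τ)
    {x y : Fin B → ℂ} (hx : x ∈ nearStdSimplex B η) (hy : y ∈ nearStdSimplex B η) (b : Fin A) :
    ‖letterStep T b x - letterStep T b y‖ ≤ 16 * B ^ 2 * (2 + B) / c ^ 2 * τ * ‖x - y‖ := by
  have hnorm : ∀ z ∈ nearStdSimplex B η, c / 2 ≤ ‖letterWeight T b z‖ := fun z hz =>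
    (h.le_re_letterWeight hη hηc hτc hz b).trans (Complex.re_le_norm _)
  have hne : ∀ z ∈ nearStdSimplex B η, letterWeight T b z ≠ 0 := fun z hz h0 => by
    have := hnorm z hz
    rw [h0, norm_zero] at this
    linarith
  refine (pi_norm_le_iff_of_nonneg (by positivity)).2 fun j => ?_
  have hnum : Matrix.vecMul x (T b) j * letterWeight T b y -
      Matrix.vecMul y (T b) j * letterWeight T b x =
      ∑ i, ∑ k, (x i - y i) * y k * (T b i j * ∑ l, T b k l - T b k j * ∑ l, T b i l) := by
    have h1 : ∑ i, ∑ k, (x i - y i) * y k * (T b i j * ∑ l, T b k l - T b k j * ∑ l, T b i l) =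
        Matrix.vecMul (x - y) (T b) j * letterWeight T b y -
          letterWeight T b (x - y) * Matrix.vecMul y (T b) j := by
      simp only [letterWeight, Matrix.vecMul, dotProduct, Finset.sum_mul_sum, Pi.sub_apply,
        ← Finset.sum_sub_distrib]
      exact Finset.sum_congr rfl fun i _ => Finset.sum_congr rfl fun k _ => by ring
    rw [h1, letterWeight_sub, Matrix.sub_vecMul, Pi.sub_apply]
    ring
  have heq : (letterStep T b x - letterStep T b y) j =
      (∑ i, ∑ k, (x i - y i) * y k * (T b i j * ∑ l, T b k l - T b k j * ∑ l, T b i l)) /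
        (letterWeight T b x * letterWeight T b y) := by
    rw [← hnum, Pi.sub_apply, letterStep, letterStep, Pi.smul_apply, Pi.smul_apply, smul_eq_mul,
      smul_eq_mul]
    have h1 := hne x hx
    have h2 := hne y hy
    field_simp
  have hterm : ∀ i k, ‖(x i - y i) * y k *
      (T b i j * ∑ l, T b k l - T b k j * ∑ l, T b i l)‖ ≤
      ‖x - y‖ * 2 * (2 * ((2 + B) * τ)) := by
    intro i k
    rw [norm_mul, norm_mul]
    exact mul_le_mul (mul_le_mul (norm_le_pi_norm (x - y) i) (norm_apply_le_two hη hy k)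
      (norm_nonneg _) (norm_nonneg _)) (h.norm_minor_le hτ b i j k) (norm_nonneg _)
      (by positivity)
  rw [heq, norm_div, norm_mul, div_le_iff₀ (mul_pos (norm_pos_iff.2 (hne x hx))
    (norm_pos_iff.2 (hne y hy)))]
  calc _ ≤ ∑ _i : Fin B, ∑ _k : Fin B, ‖x - y‖ * 2 * (2 * ((2 + B) * τ)) := by
        refine (norm_sum_le _ _).trans (Finset.sum_le_sum fun i _ => ?_)
        exact (norm_sum_le _ _).trans (Finset.sum_le_sum fun k _ => hterm i k)
    _ = 16 * B ^ 2 * (2 + B) / c ^ 2 * τ * ‖x - y‖ * (c / 2 * (c / 2)) := by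
        simp
        field_simp
        ring
    _ ≤ _ := mul_le_mul_of_nonneg_left (mul_le_mul (hnorm x hx) (hnorm y hy) (by linarith)
        (norm_nonneg _)) (by positivity)

/-- Consecutive entropy approximations near a Black Hole. -/
theorem norm_stateEntropy_succ_sub_le (h : IsNearBlackHole T T₀ c τ) (hc0 : 0 < c) (hc : c ≤ 1)
    (hη : η ≤ 1) (hηc : B * η ≤ c / 4) (hτc : 2 * B ^ 2 * τ ≤ c / 4) (hτ : B * τ ≤ 1)
    (hτη : 2 * B * ((1 + B) * τ) ≤ η * (c / 2)) (hτ0 : 0 ≤ τ) {x : Fin B → ℂ}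
    (hx : x ∈ nearStdSimplex B η) (hsum : ∑ i, x i = 1)
    (hstat : ∑ b, Matrix.vecMul x (T b) = x) (n : ℕ) :
    ‖stateEntropy T (n + 1) x - stateEntropy T n x‖ ≤
      A * ((2 * B) ^ 2 / (c / 2)) * (A * 2) * 4 ^ 2 *
        (A * 2 * (16 * B ^ 2 * (2 + B) / c ^ 2 * τ) ^ 2) ^ n := by
  refine _root_.norm_stateEntropy_succ_sub_le (K := nearStdSimplex B η) (by positivity)
    (by norm_num) (fun b x hx => h.le_re_letterWeight hη hηc hτc hx b)
    (fun b x hx => h.norm_letterWeight_le_two hc hη hηc hτc hx b)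
    (fun b x hx => h.letterStep_mem hc0 hη hηc hτc hτη hx b)
    (fun b x y => h.norm_letterWeight_sub_le hτ b x y)
    (fun b x hx y hy => h.norm_letterStep_sub_le hc0 hη hηc hτc hτ hτ0 hx hy b)
    (fun x hx y hy => ?_) hx hsum hstat n
  refine (norm_sub_le _ _).trans ?_
  have hz : ∀ z ∈ nearStdSimplex B η, ‖z‖ ≤ 2 := fun z hz =>
    (pi_norm_le_iff_of_nonneg (by norm_num)).2 fun i => norm_apply_le_two hη hz i
  linarith [hz x hx, hz y hy]

end IsNearBlackHole

/-- The entropy of a state vector depends smoothly on parameters. -/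
theorem contDiffOn_stateEntropy {A B : ℕ} {E : Type*} [NormedAddCommGroup E] [NormedSpace ℂ E]
    {s : Set E} {k : ℕ} {T : E → Fin A → Matrix (Fin B) (Fin B) ℂ} {K : Set (Fin B → ℂ)}
    (hT : ∀ b i j, ContDiffOn ℂ k (fun z => T z b i j) s)
    (hre : ∀ z ∈ s, ∀ b, ∀ x ∈ K, 0 < (letterWeight (T z) b x).re)
    (hstep : ∀ z ∈ s, ∀ b, ∀ x ∈ K, letterStep (T z) b x ∈ K) (n : ℕ) :
    ∀ {x : E → Fin B → ℂ}, (∀ i, ContDiffOn ℂ k (fun z => x z i) s) → (∀ z ∈ s, x z ∈ K) →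
      ContDiffOn ℂ k (fun z => stateEntropy (T z) n (x z)) s := by
  have hweight : ∀ b, ∀ {x : E → Fin B → ℂ}, (∀ i, ContDiffOn ℂ k (fun z => x z i) s) →
      ContDiffOn ℂ k (fun z => letterWeight (T z) b (x z)) s := fun b x hx =>
    ContDiffOn.sum fun i _ => (hx i).mul (ContDiffOn.sum fun j _ => hT b i j)
  induction n with
  | zero =>
    intro x hx hxK
    exact (ContDiffOn.sum fun b _ => (hweight b hx).mul fun z hz =>
      (Complex.contDiffAt_log (Or.inl (hre z hz b _ (hxK z hz)))).comp_contDiffWithinAt z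
        (hweight b hx z hz)).neg
  | succ n ih =>
    intro x hx hxK
    refine ContDiffOn.sum fun b _ => (hweight b hx).mul (ih (fun i => ?_) fun z hz =>
      hstep z hz b _ (hxK z hz))
    have hvec : ContDiffOn ℂ k (fun z => Matrix.vecMul (x z) (T z b) i) s := by
      simp only [Matrix.vecMul, dotProduct]
      exact ContDiffOn.sum fun j _ => (hx j).mul (hT b j i)
    refine ((hweight b hx).inv fun z hz h0 => ?_).mul hvec
    have := hre z hz b _ (hxK z hz)
    rw [h0] at this
    exact lt_irrefl _ this

end Perturbation

/-! ### Smooth dependence of the stationary vector -/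

section StationaryVector

/-- The matrix `1 - M + J`, where all entries of `J` are `1`. -/
def stationaryMatrix {B : ℕ} (M : Matrix (Fin B) (Fin B) ℂ) : Matrix (Fin B) (Fin B) ℂ :=
  1 - M + Matrix.of fun _ _ => 1

/-- The stationary row vector of a matrix with row sums `1`. -/
noncomputable def stationaryVec {B : ℕ} (M : Matrix (Fin B) (Fin B) ℂ) : Fin B → ℂ :=
  Matrix.vecMul (fun _ => 1) (stationaryMatrix M)⁻¹

/-- For a stationary `v` of total mass 1 the right side is the all-ones row, so `v` solves a linear
system whose solution is rational in the entries of `M`. -/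
theorem vecMul_stationaryMatrix {B : ℕ} (M : Matrix (Fin B) (Fin B) ℂ) (v : Fin B → ℂ) :
    Matrix.vecMul v (stationaryMatrix M) = v - Matrix.vecMul v M + fun _ => ∑ i, v i := by
  rw [stationaryMatrix, Matrix.vecMul_add, Matrix.vecMul_sub, Matrix.vecMul_one]
  congr 1
  ext j
  simp [Matrix.vecMul, dotProduct]

theorem sum_vecMul_of_rowSum_eq_one {B : ℕ} {M : Matrix (Fin B) (Fin B) ℂ}
    (hM : ∀ i, ∑ j, M i j = 1) (v : Fin B → ℂ) : ∑ j, Matrix.vecMul v M j = ∑ i, v i := by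
  simp only [Matrix.vecMul, dotProduct]
  rw [Finset.sum_comm]
  simp only [← Finset.mul_sum, hM, mul_one]

theorem sum_vecMul_stationaryMatrix {B : ℕ} {M : Matrix (Fin B) (Fin B) ℂ}
    (hM : ∀ i, ∑ j, M i j = 1) (v : Fin B → ℂ) :
    ∑ j, Matrix.vecMul v (stationaryMatrix M) j = B * ∑ i, v i := by
  simp [vecMul_stationaryMatrix, Finset.sum_add_distrib, sum_vecMul_of_rowSum_eq_one hM]

theorem vecMul_stationaryVec {B : ℕ} {M : Matrix (Fin B) (Fin B) ℂ}
    (hdet : (stationaryMatrix M).det ≠ 0) :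
    Matrix.vecMul (stationaryVec M) (stationaryMatrix M) = fun _ => 1 := by
  rw [stationaryVec, Matrix.vecMul_vecMul, Matrix.nonsing_inv_mul _ (isUnit_iff_ne_zero.2 hdet),
    Matrix.vecMul_one]

/-- Summing the coordinates of the defining system eliminates `M`, whose row sums are 1, and leaves
`B * ∑ v = B`. -/
theorem sum_stationaryVec {B : ℕ} (hB : B ≠ 0) {M : Matrix (Fin B) (Fin B) ℂ}
    (hM : ∀ i, ∑ j, M i j = 1) (hdet : (stationaryMatrix M).det ≠ 0) :
    ∑ i, stationaryVec M i = 1 := by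
  have h := sum_vecMul_stationaryMatrix hM (stationaryVec M)
  rw [vecMul_stationaryVec hdet] at h
  have hB' : (B : ℂ) ≠ 0 := Nat.cast_ne_zero.2 hB
  simp only [Finset.sum_const, Finset.card_univ, Fintype.card_fin, nsmul_eq_mul] at h
  exact (mul_left_cancel₀ hB' h).symm

theorem stationaryVec_vecMul {B : ℕ} (hB : B ≠ 0) {M : Matrix (Fin B) (Fin B) ℂ}
    (hM : ∀ i, ∑ j, M i j = 1) (hdet : (stationaryMatrix M).det ≠ 0) :
    Matrix.vecMul (stationaryVec M) M = stationaryVec M := by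
  have h := vecMul_stationaryVec hdet
  rw [vecMul_stationaryMatrix, sum_stationaryVec hB hM hdet, add_eq_right] at h
  exact (sub_eq_zero.1 h).symm

theorem eq_stationaryVec {B : ℕ} {M : Matrix (Fin B) (Fin B) ℂ}
    (hdet : (stationaryMatrix M).det ≠ 0) {v : Fin B → ℂ} (hv : Matrix.vecMul v M = v)
    (hsum : ∑ i, v i = 1) : v = stationaryVec M := by
  have h : Matrix.vecMul v (stationaryMatrix M) = fun _ => 1 := by
    rw [vecMul_stationaryMatrix, hv, hsum, sub_self, zero_add]
  rw [stationaryVec, ← h, Matrix.vecMul_vecMul,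
    Matrix.mul_nonsing_inv _ (isUnit_iff_ne_zero.2 hdet), Matrix.vecMul_one]

/-- A stochastic matrix with a positive column has a unique stationary vector. -/
theorem det_stationaryMatrix_ne_zero {B : ℕ} {M : Matrix (Fin B) (Fin B) ℝ}
    (hM : M ∈ Matrix.rowStochastic ℝ (Fin B)) {j₀ : Fin B} (hpos : ∀ i, 0 < M i j₀) :
    (stationaryMatrix (M.map (fun a => (a : ℂ)))).det ≠ 0 := by
  obtain ⟨hnn, -⟩ := Matrix.mem_rowStochastic.1 hM
  have hsumR : ∀ i, ∑ j, M i j = 1 := Matrix.sum_row_of_mem_rowStochastic hM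
  have hsum : ∀ i, ∑ j, M.map (fun a => (a : ℂ)) i j = 1 := fun i => by
    simp only [Matrix.map_apply]
    exact_mod_cast hsumR i
  intro h0
  obtain ⟨v, hv, hv0⟩ := Matrix.exists_vecMul_eq_zero_iff.2 h0
  have hB : (B : ℂ) ≠ 0 := Nat.cast_ne_zero.2 (Fin.pos j₀).ne'
  have hs : ∑ i, v i = 0 := by
    have h := sum_vecMul_stationaryMatrix hsum v
    rw [hv0] at h
    simpa [hB] using h
  have hfix : ∀ j, v j = ∑ i, v i * (M i j : ℂ) := by
    intro j
    have h := congrFun hv0 j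
    rw [vecMul_stationaryMatrix, hs] at h
    simpa [Matrix.vecMul, dotProduct, sub_eq_zero] using h
  obtain ⟨i₁, -, hi₁⟩ := Finset.exists_min_image Finset.univ (fun i => M i j₀) ⟨j₀, Finset.mem_univ _⟩
  set c := M i₁ j₀ with hc
  have hcpos : 0 < c := hpos i₁
  -- Doeblin's trick: as the entries of `v` sum to zero, lowering column `j₀` by its minimum `c`
  -- keeps `v` fixed. The resulting nonnegative matrix has row sums `1 - c`, which forces the `ℓ¹`
  -- norm of `v` to be zero.
  let Q : Fin B → Fin B → ℝ := fun i j => M i j - if j = j₀ then c else 0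
  have hQ0 : ∀ i j, 0 ≤ Q i j := fun i j => by
    simp only [Q]
    split_ifs with h
    · subst h; linarith [hi₁ i (Finset.mem_univ i)]
    · simpa using hnn i j
  have hQs : ∀ i, ∑ j, Q i j = 1 - c := fun i => by
    simp [Q, Finset.sum_sub_distrib, hsumR]
  have hfixQ : ∀ j, v j = ∑ i, v i * (Q i j : ℂ) := fun j => by
    have : ∑ i, v i * (Q i j : ℂ) = ∑ i, v i * (M i j : ℂ) -
        (∑ i, v i) * ((if j = j₀ then c else 0 : ℝ) : ℂ) := by
      simp only [Q, Complex.ofReal_sub, mul_sub, Finset.sum_sub_distrib, Finset.sum_mul]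
    rw [this, hs, zero_mul, sub_zero, ← hfix]
  have hle : ∑ j, ‖v j‖ ≤ (1 - c) * ∑ i, ‖v i‖ := by
    calc ∑ j, ‖v j‖ ≤ ∑ j, ∑ i, ‖v i‖ * Q i j := by
          refine Finset.sum_le_sum fun j _ => ?_
          conv_lhs => rw [hfixQ j]
          refine (norm_sum_le _ _).trans (le_of_eq ?_)
          refine Finset.sum_congr rfl fun i _ => ?_
          rw [norm_mul, Complex.norm_real, Real.norm_of_nonneg (hQ0 i j)]
      _ = _ := by
          rw [Finset.sum_comm]
          simp only [← Finset.mul_sum, hQs, ← Finset.sum_mul]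
          ring
  have hzero : ∑ j, ‖v j‖ = 0 := by
    have hnn' : 0 ≤ ∑ j, ‖v j‖ := Finset.sum_nonneg fun _ _ => norm_nonneg _
    nlinarith
  refine hv (funext fun j => ?_)
  simpa using (Finset.sum_eq_zero_iff_of_nonneg fun _ _ => norm_nonneg _).1 hzero j
    (Finset.mem_univ j)

theorem ContDiffOn.matrix_det {E ι : Type*} [Fintype ι] [DecidableEq ι] [NormedAddCommGroup E]
    [NormedSpace ℂ E] {s : Set E} {k : ℕ} {M : E → Matrix ι ι ℂ}
    (hM : ∀ i j, ContDiffOn ℂ k (fun z => M z i j) s) :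
    ContDiffOn ℂ k (fun z => (M z).det) s := by
  simp only [Matrix.det_apply, Units.smul_def, zsmul_eq_mul]
  exact ContDiffOn.sum fun σ _ => contDiffOn_const.mul (contDiffOn_prod fun i _ => hM _ _)

theorem contDiffOn_stationaryMatrix {B : ℕ} {E : Type*} [NormedAddCommGroup E] [NormedSpace ℂ E]
    {s : Set E} {k : ℕ} {M : E → Matrix (Fin B) (Fin B) ℂ}
    (hM : ∀ i j, ContDiffOn ℂ k (fun z => M z i j) s) (i j : Fin B) :
    ContDiffOn ℂ k (fun z => stationaryMatrix (M z) i j) s :=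
  (contDiffOn_const.sub (hM i j)).add contDiffOn_const

theorem contDiffOn_stationaryVec {B : ℕ} {E : Type*} [NormedAddCommGroup E] [NormedSpace ℂ E]
    {s : Set E} {k : ℕ} {M : E → Matrix (Fin B) (Fin B) ℂ}
    (hM : ∀ i j, ContDiffOn ℂ k (fun z => M z i j) s)
    (hdet : ∀ z ∈ s, (stationaryMatrix (M z)).det ≠ 0) (i : Fin B) :
    ContDiffOn ℂ k (fun z => stationaryVec (M z) i) s := by
  have hS := contDiffOn_stationaryMatrix hM
  simp only [stationaryVec, Matrix.vecMul, dotProduct, one_mul, Matrix.inv_def, Matrix.smul_apply,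
    Ring.inverse_eq_inv', smul_eq_mul, Matrix.adjugate_apply]
  refine ContDiffOn.sum fun j _ => ((ContDiffOn.matrix_det hS).inv hdet).mul
    (ContDiffOn.matrix_det fun a b => ?_)
  simp only [Matrix.updateRow_apply]
  split_ifs
  · exact contDiffOn_const
  · exact hS a b

end StationaryVector

/-! ### Quantitative form of the Black Hole condition -/

section BlackHole

variable {A B : ℕ} {Φ : Fin B → Fin A} {M : Matrix (Fin B) (Fin B) ℝ}

theorem symbolMatrix_apply (b : Fin A) (i j : Fin B) :
    symbolMatrix Φ M b i j = if Φ j = b then M i j else 0 := rfl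

theorem IsBlackHole.exists_pos_column (h : IsBlackHole Φ M) (b : Fin A) :
    ∃ j, ∀ i, 0 < symbolMatrix Φ M b i j := by
  by_contra hne
  push Not at hne
  have h0 : symbolMatrix Φ M b = 0 := by
    ext i j
    rcases (h b).2 j with hp | hz
    · obtain ⟨i', hi'⟩ := hne j
      exact absurd (hp i') (not_lt.2 hi')
    · exact hz i
  have := (h b).1
  rw [h0, Matrix.rank_zero] at this
  exact zero_ne_one this

/-- The column space is spanned by one vector `v`, so the entries have the form `r j * v i` and both
sides are symmetric in `i` and `k`. -/
theorem IsBlackHole.minor (h : IsBlackHole Φ M) (b : Fin A) (i j k : Fin B) :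
    symbolMatrix Φ M b i j * ∑ l, symbolMatrix Φ M b k l =
      symbolMatrix Φ M b k j * ∑ l, symbolMatrix Φ M b i l := by
  have hr := (h b).1
  rw [Matrix.rank] at hr
  obtain ⟨v, hv⟩ := finrank_le_one_iff.1 hr.le
  have hcol : ∀ j, ∃ r : ℝ, ∀ i, symbolMatrix Φ M b i j = r * v.1 i := by
    intro j
    obtain ⟨r, hr⟩ := hv ⟨(symbolMatrix Φ M b).mulVecLin (Pi.single j 1), ⟨_, rfl⟩⟩
    refine ⟨r, fun i => ?_⟩
    have := congrFun (congrArg Subtype.val hr) i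
    simpa using this.symm
  choose r hr using hcol
  simp only [hr, ← Finset.sum_mul]
  ring

theorem IsBlackHole.exists_le_rowSum (h : IsBlackHole Φ M)
    (hM : M ∈ Matrix.rowStochastic ℝ (Fin B)) :
    ∃ c, 0 < c ∧ c ≤ 1 ∧ ∀ b i, c ≤ ∑ j, symbolMatrix Φ M b i j := by
  have hnn : ∀ b i j, 0 ≤ symbolMatrix Φ M b i j := fun b i j => by
    rw [symbolMatrix_apply]
    split_ifs
    · exact (Matrix.mem_rowStochastic.1 hM).1 i j
    · exact le_rfl
  have hpos : ∀ p : Fin A × Fin B, 0 < ∑ j, symbolMatrix Φ M p.1 p.2 j := fun p => by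
    obtain ⟨j, hj⟩ := h.exists_pos_column p.1
    exact (hj p.2).trans_le (Finset.single_le_sum (fun j _ => hnn p.1 p.2 j) (Finset.mem_univ j))
  obtain ⟨c, hc, hc'⟩ : ∃ c, 0 < c ∧ ∀ p : Fin A × Fin B,
      c ≤ ∑ j, symbolMatrix Φ M p.1 p.2 j := by
    rcases isEmpty_or_nonempty (Fin A × Fin B) with he | hne
    · exact ⟨1, one_pos, fun p => he.elim p⟩
    · obtain ⟨p, hp⟩ := Finite.exists_min fun p : Fin A × Fin B => ∑ j, symbolMatrix Φ M p.1 p.2 j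
      exact ⟨_, hpos p, hp⟩
  exact ⟨min c 1, lt_min hc one_pos, min_le_right _ _, fun b i =>
    (min_le_left _ _).trans (hc' (b, i))⟩

/-- The complex letter matrices of a complex matrix. -/
def letterMatrix (Φ : Fin B → Fin A) (M : Matrix (Fin B) (Fin B) ℂ) (b : Fin A) :
    Matrix (Fin B) (Fin B) ℂ :=
  Matrix.of fun i j => if Φ j = b then M i j else 0

theorem letterMatrix_apply (M : Matrix (Fin B) (Fin B) ℂ) (b : Fin A) (i j : Fin B) :
    letterMatrix Φ M b i j = if Φ j = b then M i j else 0 := rfl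

theorem sum_letterMatrix (M : Matrix (Fin B) (Fin B) ℂ) : ∑ b, letterMatrix Φ M b = M := by
  ext i j
  simp [Matrix.sum_apply, letterMatrix_apply]

theorem IsBlackHole.isNearBlackHole (h : IsBlackHole Φ M)
    (hM : M ∈ Matrix.rowStochastic ℝ (Fin B)) {c τ : ℝ}
    (hc : ∀ b i, c ≤ ∑ j, symbolMatrix Φ M b i j) {M' : Matrix (Fin B) (Fin B) ℂ}
    (hτ : 0 ≤ τ) (hdist : ∀ i j, ‖M' i j - M i j‖ ≤ τ) :
    IsNearBlackHole (letterMatrix Φ M') (symbolMatrix Φ M) c τ where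
  nonneg b i j := by
    rw [symbolMatrix_apply]
    split_ifs
    · exact (Matrix.mem_rowStochastic.1 hM).1 i j
    · exact le_rfl
  rowSum_le b i := by
    rw [← Matrix.sum_row_of_mem_rowStochastic hM i]
    refine Finset.sum_le_sum fun j _ => ?_
    rw [symbolMatrix_apply]
    split_ifs
    · exact le_rfl
    · exact (Matrix.mem_rowStochastic.1 hM).1 i j
  le_rowSum := hc
  minor := h.minor
  dist_le b i j := by
    rw [symbolMatrix_apply, letterMatrix_apply]
    split_ifs
    · exact hdist i j
    · simpa using hτ

end BlackHole

/-! ### Entropy as a sum over words -/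

section WordVectors

/-- The unnormalised state vector after the letters `w (n - 1), …, w 0`, in this order. -/
def wordVec {A B : ℕ} (T : Fin A → Matrix (Fin B) (Fin B) ℂ) :
    (n : ℕ) → (Fin n → Fin A) → (Fin B → ℂ) → Fin B → ℂ
  | 0, _, x => x
  | n + 1, w, x => Matrix.vecMul (wordVec T n (Fin.tail w) x) (T (w 0))

/-- `wordVec` splits off the latest letter, `stateEntropy` the oldest one; this identity reconciles
the two recursions. -/
theorem wordVec_succ_eq_init {A B : ℕ} (T : Fin A → Matrix (Fin B) (Fin B) ℂ) (n : ℕ) :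
    ∀ (w : Fin (n + 1) → Fin A) (x : Fin B → ℂ),
      wordVec T (n + 1) w x =
        wordVec T n (Fin.init w) (Matrix.vecMul x (T (w (Fin.last n)))) := by
  induction n with
  | zero => intro w x; rfl
  | succ n ih =>
    intro w x
    rw [wordVec, ih, wordVec, Fin.tail_init_eq_init_tail]
    rfl

/-- The conditional entropy of the next letter, as a function of the unnormalised state vector. -/
noncomputable def letterEntropy {A B : ℕ} (T : Fin A → Matrix (Fin B) (Fin B) ℂ)
    (y : Fin B → ℂ) : ℂ :=
  -∑ b, letterWeight T b y * Complex.log (letterWeight T b y / ∑ j, y j)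

/-- `letterEntropy` is homogeneous of degree one, because the quotient inside the logarithm is scale
invariant. The scalar `s` therefore collects the product of the weights already emitted, and no
logarithm of a product arises. -/
theorem sum_letterEntropy_wordVec {A B : ℕ} {T : Fin A → Matrix (Fin B) (Fin B) ℂ}
    {K : Set (Fin B → ℂ)} (hne : ∀ b, ∀ x ∈ K, letterWeight T b x ≠ 0)
    (hstep : ∀ b, ∀ x ∈ K, letterStep T b x ∈ K) (n : ℕ) :
    ∀ {x : Fin B → ℂ} (s : ℂ), x ∈ K → ∑ i, x i = 1 →
      ∑ w : Fin n → Fin A, letterEntropy T (wordVec T n w (s • x)) = s * stateEntropy T n x := by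
  induction n with
  | zero =>
    intro x s hx hsum
    simp only [wordVec, Finset.univ_unique, Finset.sum_singleton, letterEntropy, stateEntropy,
      letterWeight_smul, Pi.smul_apply, smul_eq_mul, ← Finset.mul_sum, hsum, mul_one]
    rcases eq_or_ne s 0 with rfl | hs
    · simp
    · simp only [mul_div_cancel_left₀ _ hs, mul_assoc, ← Finset.mul_sum, mul_neg]
  | succ n ih =>
    intro x s hx hsum
    rw [← (Fin.snocEquiv fun _ => Fin A).sum_comp, Fintype.sum_prod_type, stateEntropy,
      Finset.mul_sum]
    refine Finset.sum_congr rfl fun b _ => ?_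
    have hvec : Matrix.vecMul (s • x) (T b) =
        (s * letterWeight T b x) • letterStep T b x := by
      rw [letterStep, smul_smul, mul_assoc, mul_inv_cancel₀ (hne b x hx), mul_one,
        Matrix.smul_vecMul]
    have hsum' : ∑ i, letterStep T b x i = 1 := by
      simp only [letterStep, Pi.smul_apply, smul_eq_mul, ← Finset.mul_sum,
        ← letterWeight_eq_sum_vecMul, inv_mul_cancel₀ (hne b x hx)]
    rw [← mul_assoc, ← ih (s * letterWeight T b x) (hstep b x hx) hsum']
    refine Finset.sum_congr rfl fun w _ => ?_
    rw [wordVec_succ_eq_init]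
    simp [Fin.snocEquiv, hvec]

end WordVectors

/-! ### Probabilities of the hidden chain as matrix products -/

namespace IsStationaryMarkovChain

variable {Ω : Type*} [MeasurableSpace Ω] {A B : ℕ} {P : Measure Ω} {Y : ℤ → Ω → Fin B}
  {Δ : Matrix (Fin B) (Fin B) ℝ}

theorem measureReal_eq_sum_inter {β : Type*} [Fintype β] [MeasurableSpace β]
    [MeasurableSingletonClass β] [IsFiniteMeasure P] {X : Ω → β} (hX : Measurable X)
    {S : Set Ω} : P.real S = ∑ x, P.real {ω | ω ∈ S ∧ X ω = x} := by
  have h := sum_measureReal_preimage_singleton (μ := P.restrict S) Finset.univ (f := X)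
    (fun y _ => hX (measurableSet_singleton y))
  rw [Finset.coe_univ, Set.preimage_univ, measureReal_restrict_apply MeasurableSet.univ,
    Set.univ_inter] at h
  rw [← h]
  refine Finset.sum_congr rfl fun x _ => ?_
  rw [measureReal_restrict_apply (hX (measurableSet_singleton x)), Set.inter_comm]
  rfl

/-- The Markov property, given an arbitrary event of the past. -/
theorem measureReal_succ (h : IsStationaryMarkovChain P Y Δ) (k : ℤ) (n : ℕ)
    (S : (Fin (n + 1) → Fin B) → Prop) (i j : Fin B) :
    P.real {ω | (S (fun l => Y (k + (l : ℕ)) ω) ∧ Y (k + n) ω = i) ∧ Y (k + n + 1) ω = j} =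
      P.real {ω | S (fun l => Y (k + (l : ℕ)) ω) ∧ Y (k + n) ω = i} * Δ i j := by
  have := h.isProbabilityMeasure
  have hX : Measurable fun ω => fun l : Fin (n + 1) => Y (k + (l : ℕ)) ω :=
    measurable_pi_lambda _ fun l => h.measurable _
  rw [measureReal_eq_sum_inter hX, measureReal_eq_sum_inter (S := {ω | _ ∧ _}) hX, Finset.sum_mul]
  refine Finset.sum_congr rfl fun f _ => ?_
  by_cases hf : S f ∧ f (Fin.last n) = i
  · let y : ℕ → Fin B := fun l =>
      if hl : l ≤ n then f ⟨l, Nat.lt_succ_of_le hl⟩ else j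
    have hm := h.markov k n y
    have hyn : y n = i := by
      simp only [y, le_refl, dite_true]
      exact hf.2
    have hyn1 : y (n + 1) = j := by simp [y]
    have hpath : ∀ ω, (∀ l ≤ n, Y (k + (l : ℕ)) ω = y l) ↔
        (fun l : Fin (n + 1) => Y (k + (l : ℕ)) ω) = f := by
      intro ω
      refine ⟨fun hl => funext fun l => ?_, fun hl l hln => ?_⟩
      · have := hl l (Nat.lt_succ_iff.1 l.2)
        simpa [y, Nat.lt_succ_iff.1 l.2] using this
      · have := congrFun hl ⟨l, Nat.lt_succ_iff.2 hln⟩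
        simpa [y, hln] using this
    rw [hyn, hyn1] at hm
    have e1 : {ω | ω ∈ {ω | (S (fun l => Y (k + (l : ℕ)) ω) ∧ Y (k + n) ω = i) ∧
        Y (k + n + 1) ω = j} ∧ (fun l : Fin (n + 1) => Y (k + (l : ℕ)) ω) = f} =
        {ω | ∀ l ≤ n + 1, Y (k + (l : ℕ)) ω = y l} := by
      ext ω
      simp only [Set.mem_ofPred_eq]
      constructor
      · rintro ⟨⟨-, hj⟩, hf'⟩ l hl
        rcases Nat.lt_or_eq_of_le hl with hl | rfl
        · exact (hpath ω).2 hf' l (Nat.lt_succ_iff.1 hl)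
        · rw [hyn1, ← hj]
          push_cast
          rw [add_assoc]
      · intro hl
        have hf' := (hpath ω).1 fun l hln => hl l (hln.trans (Nat.le_succ n))
        refine ⟨⟨⟨by rw [hf']; exact hf.1, ?_⟩, ?_⟩, hf'⟩
        · rw [hl n (Nat.le_succ n), hyn]
        · have := hl (n + 1) le_rfl
          rw [hyn1] at this
          push_cast at this
          rwa [← add_assoc] at this
    have e2 : {ω | ω ∈ {ω | S (fun l => Y (k + (l : ℕ)) ω) ∧ Y (k + n) ω = i} ∧
        (fun l : Fin (n + 1) => Y (k + (l : ℕ)) ω) = f} =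
        {ω | ∀ l ≤ n, Y (k + (l : ℕ)) ω = y l} := by
      ext ω
      simp only [Set.mem_ofPred_eq]
      refine ⟨fun hω => (hpath ω).2 hω.2, fun hl => ?_⟩
      have hf' := (hpath ω).1 hl
      refine ⟨⟨by rw [hf']; exact hf.1, ?_⟩, hf'⟩
      rw [hl n le_rfl, hyn]
    rw [e1, e2, hm]
  · have hempty : ∀ ω, (fun l : Fin (n + 1) => Y (k + (l : ℕ)) ω) = f →
        ¬(S (fun l => Y (k + (l : ℕ)) ω) ∧ Y (k + n) ω = i) := by
      rintro ω hω ⟨h1, h2⟩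
      refine hf ⟨hω ▸ h1, ?_⟩
      rw [← hω]
      simpa using h2
    have e1 : {ω | ω ∈ {ω | (S (fun l => Y (k + (l : ℕ)) ω) ∧ Y (k + n) ω = i) ∧
        Y (k + n + 1) ω = j} ∧ (fun l : Fin (n + 1) => Y (k + (l : ℕ)) ω) = f} = ∅ :=
      Set.eq_empty_of_forall_notMem fun ω hω => hempty ω hω.2 hω.1.1
    have e2 : {ω | ω ∈ {ω | S (fun l => Y (k + (l : ℕ)) ω) ∧ Y (k + n) ω = i} ∧
        (fun l : Fin (n + 1) => Y (k + (l : ℕ)) ω) = f} = ∅ :=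
      Set.eq_empty_of_forall_notMem fun ω hω => hempty ω hω.2 hω.1
    rw [e1, e2, measureReal_empty, zero_mul]

theorem measureReal_eq (h : IsStationaryMarkovChain P Y Δ) (t : ℤ) (j : Fin B) :
    P.real {ω | Y t ω = j} = P.real {ω | Y 0 ω = j} := by
  simpa using h.stationary t 0 fun _ => j

theorem law_mem_stdSimplex (h : IsStationaryMarkovChain P Y Δ) :
    (fun j => P.real {ω | Y 0 ω = j}) ∈ stdSimplex ℝ (Fin B) := by
  have := h.isProbabilityMeasure
  refine ⟨fun j => measureReal_nonneg, ?_⟩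
  have h1 := measureReal_eq_sum_inter (P := P) (h.measurable 0) (S := Set.univ)
  rw [probReal_univ] at h1
  simpa using h1.symm

theorem law_vecMul (h : IsStationaryMarkovChain P Y Δ) :
    Matrix.vecMul (fun j => P.real {ω | Y 0 ω = j}) Δ = fun j => P.real {ω | Y 0 ω = j} := by
  have := h.isProbabilityMeasure
  ext j
  have h1 := measureReal_eq_sum_inter (P := P) (h.measurable 0) (S := {ω | Y 1 ω = j})
  rw [h.measureReal_eq] at h1
  rw [h1, Matrix.vecMul, dotProduct]
  refine Finset.sum_congr rfl fun i _ => ?_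
  have h2 := h.measureReal_succ 0 0 (fun _ => True) i j
  simp only [true_and, Nat.cast_zero, add_zero, zero_add] at h2
  rw [← h2]
  congr 1
  ext ω
  exact and_comm

/-- The joint law of the last `n` letters and the current state. -/
theorem law_wordVec (h : IsStationaryMarkovChain P Y Δ) (Φ : Fin B → Fin A) (n : ℕ) :
    ∀ (t : ℤ) (w : Fin n → Fin A) (j : Fin B),
      ((P.real {ω | (∀ i : Fin n, Φ (Y (t - (i : ℕ)) ω) = w i) ∧ Y t ω = j} : ℝ) : ℂ) =
        wordVec (letterMatrix Φ (Δ.map fun a => (a : ℂ))) n w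
          (fun j => ((P.real {ω | Y 0 ω = j} : ℝ) : ℂ)) j := by
  have := h.isProbabilityMeasure
  induction n with
  | zero =>
    intro t w j
    simp [wordVec, h.measureReal_eq]
  | succ n ih =>
    intro t w j
    have hset : {ω | (∀ i : Fin (n + 1), Φ (Y (t - (i : ℕ)) ω) = w i) ∧ Y t ω = j} =
        {ω | Φ j = w 0 ∧ (∀ i : Fin n, Φ (Y (t - 1 - (i : ℕ)) ω) = Fin.tail w i) ∧
          Y t ω = j} := by
      ext ω
      simp only [Set.mem_ofPred_eq, Fin.forall_fin_succ, Fin.tail, Fin.val_zero, Fin.val_succ,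
        Nat.cast_zero, sub_zero, Nat.cast_add, Nat.cast_one]
      have : ∀ i : Fin n, t - ((i : ℕ) + 1 : ℤ) = t - 1 - (i : ℕ) := fun i => by ring
      simp only [this]
      constructor
      · rintro ⟨⟨h1, h2⟩, h3⟩
        exact ⟨h3 ▸ h1, h2, h3⟩
      · rintro ⟨h1, h2, h3⟩
        exact ⟨⟨h3 ▸ h1, h2⟩, h3⟩
    have hmain : ((P.real {ω | (∀ i : Fin n, Φ (Y (t - 1 - (i : ℕ)) ω) = Fin.tail w i) ∧
        Y t ω = j} : ℝ) : ℂ) = ∑ i, wordVec (letterMatrix Φ (Δ.map fun a => (a : ℂ))) n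
          (Fin.tail w) (fun j => ((P.real {ω | Y 0 ω = j} : ℝ) : ℂ)) i * (Δ i j : ℂ) := by
      rw [measureReal_eq_sum_inter (h.measurable (t - 1))]
      push_cast
      refine Finset.sum_congr rfl fun i _ => ?_
      rw [← ih (t - 1)]
      -- Coordinate `n - i` of the path started at time `t - 1 - n` is the state at time `t - 1 -
      -- i`. Coordinate 0 is left unconstrained.
      have h2 := h.measureReal_succ (t - 1 - n) n
        (fun f => ∀ i : Fin n, Φ (f ⟨n - i, by omega⟩) = Fin.tail w i) i j
      have hidx : ∀ i : Fin n, t - 1 - (n : ℤ) + ((n - (i : ℕ) : ℕ) : ℤ) = t - 1 - (i : ℕ) :=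
        fun i => by
          rw [Nat.cast_sub i.2.le]
          ring
      simp only [hidx, sub_add_cancel] at h2
      rw [← Complex.ofReal_mul, ← h2]
      congr 2
      ext ω
      simp only [Set.mem_ofPred_eq]
      tauto
    rw [hset, wordVec]
    simp only [Matrix.vecMul, dotProduct, letterMatrix_apply, Matrix.map_apply]
    by_cases hj : Φ j = w 0
    · simp only [hj, true_and, if_true]
      exact hmain
    · simp [hj]

/-- The entropy approximations of the hidden chain in terms of word vectors. -/
theorem entropyApprox_eq (h : IsStationaryMarkovChain P Y Δ) (Φ : Fin B → Fin A) (n : ℕ) :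
    ((entropyApprox P (hiddenChain Φ Y) n : ℝ) : ℂ) =
      ∑ w : Fin n → Fin A, letterEntropy (letterMatrix Φ (Δ.map fun a => (a : ℂ)))
        (wordVec (letterMatrix Φ (Δ.map fun a => (a : ℂ))) n w
          (fun j => ((P.real {ω | Y 0 ω = j} : ℝ) : ℂ))) := by
  have := h.isProbabilityMeasure
  set T := letterMatrix Φ (Δ.map fun a => (a : ℂ)) with hT
  set π : Fin B → ℂ := fun j => ((P.real {ω | Y 0 ω = j} : ℝ) : ℂ) with hπ
  let W : Ω → Fin n → Fin A := fun ω k => hiddenChain Φ Y (-((k : ℕ) : ℤ) - 1) ω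
  have hW : ∀ w, ((P.real {ω | W ω = w} : ℝ) : ℂ) = ∑ j, wordVec T n w π j := by
    intro w
    rw [measureReal_eq_sum_inter (h.measurable (-1))]
    push_cast
    refine Finset.sum_congr rfl fun j _ => ?_
    rw [← h.law_wordVec Φ n (-1) w j]
    congr 2
    ext ω
    simp only [Set.mem_ofPred_eq, W, hiddenChain, funext_iff]
    have : ∀ k : Fin n, -((k : ℕ) : ℤ) - 1 = -1 - (k : ℕ) := fun k => by ring
    simp only [this]
  have hZW : ∀ a w, ((P.real {ω | hiddenChain Φ Y 0 ω = a ∧ W ω = w} : ℝ) : ℂ) =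
      letterWeight T a (wordVec T n w π) := by
    intro a w
    rw [measureReal_eq_sum_inter (h.measurable 0), letterWeight_eq_sum_vecMul]
    push_cast
    refine Finset.sum_congr rfl fun j _ => ?_
    have h1 := h.law_wordVec Φ (n + 1) 0 (Fin.cons a w) j
    rw [wordVec, Fin.tail_cons, Fin.cons_zero] at h1
    rw [← h1]
    congr 2
    ext ω
    simp only [Set.mem_ofPred_eq, W, hiddenChain, funext_iff, Fin.forall_fin_succ, Fin.val_zero,
      Fin.val_succ, Fin.cons_zero, Fin.cons_succ, Nat.cast_zero, sub_zero, Nat.cast_add,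
      Nat.cast_one]
    have : ∀ k : Fin n, (0 : ℤ) - ((k : ℕ) + 1 : ℤ) = -((k : ℕ) : ℤ) - 1 := fun k => by ring
    simp only [this]
  have hcast : ((entropyApprox P (hiddenChain Φ Y) n : ℝ) : ℂ) =
      -∑ a, ∑ w, ((P.real {ω | hiddenChain Φ Y 0 ω = a ∧ W ω = w} : ℝ) : ℂ) *
        Complex.log (((P.real {ω | hiddenChain Φ Y 0 ω = a ∧ W ω = w} : ℝ) : ℂ) /
          ((P.real {ω | W ω = w} : ℝ) : ℂ)) := by
    rw [entropyApprox, condEntropy]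
    push_cast
    refine congrArg Neg.neg (Finset.sum_congr rfl fun a _ => Finset.sum_congr rfl fun w _ => ?_)
    rw [Complex.ofReal_log (div_nonneg measureReal_nonneg measureReal_nonneg)]
    push_cast
    rfl
  rw [hcast]
  simp only [hW, hZW, letterEntropy, Finset.sum_neg_distrib]
  rw [Finset.sum_comm]

end IsStationaryMarkovChain

/-! ### From geometric convergence to equality of derivatives -/

section GeometricLimit

/-- If holomorphic functions `H n` satisfy `‖H (n + 1) - H n‖ ≤ C₀ (C₁ ‖z - z₀‖²) ^ n` near a real
point `z₀`, then the limit of their real parts and the `N`-th real part have the same partial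
derivatives of order `N` at `z₀`. -/
theorem mixedPartialWithin_limUnder_eq {m N : ℕ} (hN : 1 ≤ N) {D : Set (Fin m → ℝ)}
    (hD : UniqueDiffOn ℝ D) {x₀ : Fin m → ℝ} (hx₀ : x₀ ∈ D) {f : ℕ → (Fin m → ℝ) → ℝ}
    {H : ℕ → (Fin m → ℂ) → ℂ} {r C₀ C₁ : ℝ} (hr : 0 < r) (hr1 : r ≤ 1) (hC₁ : 0 ≤ C₁)
    (hsmall : C₁ * r ^ 2 ≤ 1 / 2)
    (hH : ∀ n, ∀ k : ℕ, ContDiffOn ℂ k (H n) (Metric.ball (ofRealPi m x₀) r))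
    (hdist : ∀ n, ∀ z ∈ Metric.ball (ofRealPi m x₀) r,
      ‖H (n + 1) z - H n z‖ ≤ C₀ * (C₁ * ‖z - ofRealPi m x₀‖ ^ 2) ^ n)
    (hf : ∀ n, ∀ x ∈ D, dist x x₀ < r → (f n x : ℂ) = H n (ofRealPi m x)) :
    (∀ᶠ x in 𝓝[D] x₀, Tendsto (fun n => f n x) atTop (𝓝 (limUnder atTop fun n => f n x))) ∧
    ContDiffWithinAt ℝ N (fun x => limUnder atTop fun n => f n x) D x₀ ∧
    ContDiffWithinAt ℝ N (f N) D x₀ ∧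
    ∀ i : Fin N → Fin m,
      mixedPartialWithin D i (fun x => limUnder atTop fun n => f n x) x₀ =
        mixedPartialWithin D i (f N) x₀ := by
  set z₀ := ofRealPi m x₀ with hz₀
  have hq : ∀ z ∈ Metric.ball z₀ r, C₁ * ‖z - z₀‖ ^ 2 ≤ 1 / 2 := fun z hz => by
    rw [mem_ball_iff_norm] at hz
    refine le_trans ?_ hsmall
    gcongr
  have hdist' : ∀ z ∈ Metric.ball z₀ r, ∀ n,
      dist (H n z) (H (n + 1) z) ≤ C₀ * (C₁ * ‖z - z₀‖ ^ 2) ^ n := fun z hz n => by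
    rw [dist_comm, dist_eq_norm]
    exact hdist n z hz
  have hC₀ : 0 ≤ C₀ := by
    have := (norm_nonneg _).trans (hdist 0 z₀ (Metric.mem_ball_self hr))
    simpa using this
  have hlim : ∀ z, ∃ L, z ∈ Metric.ball z₀ r → Tendsto (fun n => H n z) atTop (𝓝 L) := by
    intro z
    by_cases hz : z ∈ Metric.ball z₀ r
    · obtain ⟨L, hL⟩ := cauchySeq_tendsto_of_complete
        (cauchySeq_of_le_geometric _ _ ((hq z hz).trans_lt (by norm_num)) (hdist' z hz))
      exact ⟨L, fun _ => hL⟩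
    · exact ⟨0, fun h => absurd h hz⟩
  choose G hG using hlim
  -- The ratio is at most `1 / 2`, so the geometric tail costs a factor 2.
  have hGdist : ∀ z ∈ Metric.ball z₀ r, ∀ n,
      ‖H n z - G z‖ ≤ 2 * C₀ * (C₁ * ‖z - z₀‖ ^ 2) ^ n := by
    intro z hz n
    have hq' := hq z hz
    have h := dist_le_of_le_geometric_of_tendsto _ _ (hq'.trans_lt (by norm_num)) (hdist' z hz)
      (hG z hz) n
    rw [dist_eq_norm] at h
    refine h.trans ?_
    rw [div_le_iff₀ (by linarith)]
    have : 0 ≤ C₀ * (C₁ * ‖z - z₀‖ ^ 2) ^ n := by positivity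
    nlinarith
  have hunif : TendstoUniformlyOn H G atTop (Metric.ball z₀ r) := by
    rw [Metric.tendstoUniformlyOn_iff]
    intro ε hε
    have ht : Tendsto (fun n : ℕ => 2 * C₀ * (1 / 2 : ℝ) ^ n) atTop (𝓝 (2 * C₀ * 0)) :=
      (tendsto_pow_atTop_nhds_zero_of_lt_one (by norm_num) (by norm_num)).const_mul _
    rw [mul_zero] at ht
    filter_upwards [ht.eventually (gt_mem_nhds hε)] with n hn z hz
    rw [dist_comm, dist_eq_norm]
    refine (hGdist z hz n).trans_lt (lt_of_le_of_lt ?_ hn)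
    have := hq z hz
    gcongr
  have hGsmooth : ContDiffOn ℂ N G (Metric.ball z₀ r) :=
    contDiffOn_of_tendstoUniformlyOn_ball Metric.isOpen_ball N (fun n => hH n N) fun x hx => by
      obtain ⟨t, ht, hsub⟩ := Metric.isOpen_iff.1 Metric.isOpen_ball x hx
      exact ⟨t, ht, hunif.mono hsub⟩
  have hmem : ∀ x, dist x x₀ < r → ofRealPi m x ∈ Metric.ball z₀ r := fun x hx => by
    rwa [mem_ball_iff_norm, hz₀, ← map_sub, norm_ofRealPi, ← dist_eq_norm]
  have hconv : ∀ x ∈ D, dist x x₀ < r →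
      Tendsto (fun n => f n x) atTop (𝓝 (G (ofRealPi m x)).re) := by
    intro x hx hxr
    have h := (Complex.continuous_re.tendsto _).comp (hG _ (hmem x hxr))
    refine h.congr fun n => ?_
    rw [Function.comp_apply, ← hf n x hx hxr, Complex.ofReal_re]
  have hnear : ∀ᶠ x in 𝓝[D] x₀, x ∈ D ∧ dist x x₀ < r :=
    (eventually_mem_nhdsWithin).and
      (mem_nhdsWithin_of_mem_nhds (Metric.ball_mem_nhds x₀ hr))
  have hfeq : ∀ x ∈ D, dist x x₀ < r → f N x = (H N (ofRealPi m x)).re := fun x hx hxr => by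
    rw [← hf N x hx hxr, Complex.ofReal_re]
  have hsmoothat : ∀ {F : (Fin m → ℂ) → ℂ}, ContDiffOn ℂ N F (Metric.ball z₀ r) →
      ContDiffAt ℝ N (fun x => (F (ofRealPi m x)).re) x₀ := fun {F} hF =>
    Complex.reCLM.contDiff.contDiffAt.comp x₀
      (((hF.contDiffAt (Metric.ball_mem_nhds z₀ hr)).restrict_scalars ℝ).comp x₀
        (ofRealPi m).contDiff.contDiffAt)
  have hself : dist x₀ x₀ < r := by simpa using hr
  have hEg : (fun x => limUnder atTop fun n => f n x) =ᶠ[𝓝[D] x₀]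
      fun x => (G (ofRealPi m x)).re := by
    filter_upwards [hnear] with x hx
    exact (hconv x hx.1 hx.2).limUnder_eq
  have hEf : f N =ᶠ[𝓝[D] x₀] fun x => (H N (ofRealPi m x)).re := by
    filter_upwards [hnear] with x hx
    exact hfeq x hx.1 hx.2
  have hEg₀ : (limUnder atTop fun n => f n x₀) = (G (ofRealPi m x₀)).re :=
    (hconv x₀ hx₀ hself).limUnder_eq
  have hEf₀ : f N x₀ = (H N (ofRealPi m x₀)).re := hfeq x₀ hx₀ hself
  refine ⟨?_, ?_, ?_, fun i => ?_⟩
  · filter_upwards [hnear] with x hx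
    have h := hconv x hx.1 hx.2
    rwa [h.limUnder_eq]
  · exact (hsmoothat hGsmooth).contDiffWithinAt.congr_of_eventuallyEq hEg hEg₀
  · exact (hsmoothat (hH N N)).contDiffWithinAt.congr_of_eventuallyEq hEf hEf₀
  · have hzero : iteratedFDeriv ℝ N (fun x => ((G - H N) (ofRealPi m x)).re) x₀ = 0 := by
      refine iteratedFDeriv_re_comp_ofRealPi_eq_zero (C := 2 * C₀ * C₁ ^ N) hr
        (hGsmooth.sub (hH N N)) fun z hz => ?_
      rw [Pi.sub_apply, norm_sub_rev]
      refine (hGdist z hz N).trans ?_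
      rw [mul_pow, ← pow_mul, ← mul_assoc]
      -- On the unit ball the exponent `2 * N` may be lowered to `N + 1`; this is where `1 ≤ N`
      -- enters.
      have hz1 : ‖z - z₀‖ ≤ 1 := (mem_ball_iff_norm.1 hz).le.trans hr1
      exact mul_le_mul_of_nonneg_left
        (pow_le_pow_of_le_one (norm_nonneg _) hz1 (by omega)) (by positivity)
    have hsub : (fun x => ((G - H N) (ofRealPi m x)).re) =
        (fun x => (G (ofRealPi m x)).re) - fun x => (H N (ofRealPi m x)).re := by
      ext x
      simp
    rw [hsub, iteratedFDeriv_sub_apply (hsmoothat hGsmooth) (hsmoothat (hH N N)), sub_eq_zero]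
      at hzero
    -- On `D` both functions coincide near `x₀` with functions smooth on a full neighbourhood, and
    -- unique differentiability identifies derivatives within `D` with full ones.
    rw [mixedPartialWithin, mixedPartialWithin, hEg.iteratedFDerivWithin_eq hEg₀,
      hEf.iteratedFDerivWithin_eq hEf₀,
      iteratedFDerivWithin_eq_iteratedFDeriv hD (hsmoothat hGsmooth) hx₀,
      iteratedFDerivWithin_eq_iteratedFDeriv hD (hsmoothat (hH N N)) hx₀, hzero]

end GeometricLimit

/-! ### Complex extension of the transition matrix -/

section StochasticExtension

/-- A real analytic family of stochastic matrices extends locally to a smooth family of complex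
matrices with row sums `1`. -/
theorem exists_complex_extension_of_rowStochastic {B m : ℕ} (hB : B ≠ 0) {D : Set (Fin m → ℝ)}
    {Δ : (Fin m → ℝ) → Matrix (Fin B) (Fin B) ℝ}
    (hΔ : ∀ ε ∈ D, Δ ε ∈ Matrix.rowStochastic ℝ (Fin B)) {x₀ : Fin m → ℝ}
    (hana : ∀ i j, AnalyticWithinAt ℝ (fun ε => Δ ε i j) D x₀) :
    ∃ M : (Fin m → ℂ) → Matrix (Fin B) (Fin B) ℂ, ∃ R > 0,
      (∀ i j, ∀ k : ℕ, ContDiffOn ℂ k (fun z => M z i j) (Metric.ball (ofRealPi m x₀) R)) ∧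
      (∀ z i, ∑ j, M z i j = 1) ∧
      ∀ x ∈ D, dist x x₀ < R → M (ofRealPi m x) = (Δ x).map fun a => (a : ℂ) := by
  choose F r hr hF hFΔ using fun p : Fin B × Fin B => (hana p.1 p.2).exists_complex_extension
  have hBpos : 0 < B := Nat.pos_of_ne_zero hB
  have : Nonempty (Fin B × Fin B) := ⟨(⟨0, hBpos⟩, ⟨0, hBpos⟩)⟩
  obtain ⟨p₀, hp₀⟩ := Finite.exists_min r
  have hBC : (B : ℂ) ≠ 0 := Nat.cast_ne_zero.2 hB
  have hF' : ∀ p, ∀ k : ℕ, ContDiffOn ℂ k (F p) (Metric.ball (ofRealPi m x₀) (r p₀)) :=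
    fun p k => (hF p k).mono (Metric.ball_subset_ball (hp₀ p))
  -- Extending entries separately may destroy the row sums, so the defect is spread evenly over each
  -- row. It vanishes at the points of `D`, where the row sums are already 1.
  refine ⟨fun z => Matrix.of fun i j => F (i, j) z + (1 - ∑ l, F (i, l) z) / B, r p₀, hr p₀,
    fun i j k => ?_, fun z i => ?_, fun x hx hxr => ?_⟩
  · exact (hF' _ k).add
      ((contDiffOn_const.sub (ContDiffOn.sum fun l _ => hF' _ k)).div_const _)
  · simp only [Matrix.of_apply, Finset.sum_add_distrib, Finset.sum_const, Finset.card_univ,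
      Fintype.card_fin, nsmul_eq_mul, mul_div_cancel₀ _ hBC]
    ring
  · ext i j
    have hsum : ∑ l, (Δ x i l : ℂ) = 1 := by
      exact_mod_cast Matrix.sum_row_of_mem_rowStochastic (hΔ x hx) i
    have h : ∀ l, F (i, l) (ofRealPi m x) = Δ x i l := fun l =>
      hFΔ (i, l) x hx (hxr.trans_le (hp₀ _))
    simp [h, hsum]

/-- A finite family of functions that are differentiable at `z₀` is locally Lipschitz at `z₀`. -/
theorem exists_eventually_norm_sub_le {E ι : Type*} [Finite ι] [NormedAddCommGroup E]
    [NormedSpace ℂ E] {f : ι → E → ℂ} {z₀ : E} (hf : ∀ i, DifferentiableAt ℂ (f i) z₀) :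
    ∃ C, 0 ≤ C ∧ ∀ᶠ z in 𝓝 z₀, ∀ i, ‖f i z - f i z₀‖ ≤ C * ‖z - z₀‖ := by
  have := Fintype.ofFinite ι
  choose C hC hCf using fun i => (hf i).isBigO_sub.exists_nonneg
  refine ⟨∑ i, C i, Finset.sum_nonneg fun i _ => hC i, ?_⟩
  rw [eventually_all]
  intro i
  filter_upwards [(hCf i).bound] with z hz
  refine hz.trans (mul_le_mul_of_nonneg_right ?_ (norm_nonneg _))
  exact Finset.single_le_sum (fun i _ => hC i) (Finset.mem_univ i)

end StochasticExtension

/-! ### Entropy rate at a Black Hole -/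

theorem mainTheorem2 {A B m : ℕ} (Φ : Fin B → Fin A)
    (D : Set (Fin m → ℝ)) (hD : UniqueDiffOn ℝ D)
    (Δ : (Fin m → ℝ) → Matrix (Fin B) (Fin B) ℝ)
    (hΔ : ∀ ε ∈ D, Δ ε ∈ Matrix.rowStochastic ℝ (Fin B))
    (hΔ_analytic : ∀ i j, AnalyticOn ℝ (fun ε => Δ ε i j) D)
    {Ω : Type*} [MeasurableSpace Ω]
    (P : (Fin m → ℝ) → Measure Ω) (Y : (Fin m → ℝ) → ℤ → Ω → Fin B)
    (hY : ∀ ε ∈ D, IsStationaryMarkovChain (P ε) (Y ε) (Δ ε))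
    (ε₀ : Fin m → ℝ) (hε₀ : ε₀ ∈ D) (hBH : IsBlackHole Φ (Δ ε₀))
    (N : ℕ) (hN : 1 ≤ N) :
    -- the limit that defines the entropy rate exists for all parameters in `D` near `ε₀`
    (∀ᶠ ε in 𝓝[D] ε₀, Tendsto (fun n => entropyApprox (P ε) (hiddenChain Φ (Y ε)) n) atTop
      (𝓝 (entropyRate (P ε) (hiddenChain Φ (Y ε))))) ∧
    -- the derivatives of order `N` exist
    ContDiffWithinAt ℝ N (fun ε => entropyRate (P ε) (hiddenChain Φ (Y ε))) D ε₀ ∧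
    ContDiffWithinAt ℝ N (fun ε => entropyApprox (P ε) (hiddenChain Φ (Y ε)) N) D ε₀ ∧
    -- and they agree
    ∀ i : Fin N → Fin m,
      mixedPartialWithin D i (fun ε => entropyRate (P ε) (hiddenChain Φ (Y ε))) ε₀ =
        mixedPartialWithin D i (fun ε => entropyApprox (P ε) (hiddenChain Φ (Y ε)) N) ε₀ := by
  have hB : B ≠ 0 := by
    rintro rfl
    have h := (hY ε₀ hε₀).law_mem_stdSimplex.2
    simp at h
  have hBpos : (0 : ℝ) < B := Nat.cast_pos.2 (Nat.pos_of_ne_zero hB)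
  obtain ⟨M, R, hR, hM, hMsum, hMΔ⟩ := exists_complex_extension_of_rowStochastic hB hΔ
    fun i j => hΔ_analytic i j ε₀ hε₀
  set z₀ := ofRealPi m ε₀ with hz₀
  have hM₀ : M z₀ = (Δ ε₀).map fun a => (a : ℂ) := hMΔ ε₀ hε₀ (by simpa using hR)
  obtain ⟨c, hc0, hc1, hc⟩ := hBH.exists_le_rowSum (hΔ ε₀ hε₀)
  obtain ⟨C, hC, hlip⟩ := exists_eventually_norm_sub_le (z₀ := z₀)
    (f := fun p : Fin B × Fin B => fun z => M z p.1 p.2) fun p =>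
      ((hM p.1 p.2 1).contDiffAt (Metric.ball_mem_nhds z₀ hR)).differentiableAt (by simp)
  set η : ℝ := min 1 (c / (4 * B)) with hη
  have hηpos : 0 < η := by positivity
  have hη1 : η ≤ 1 := min_le_left _ _
  have hηc : B * η ≤ c / 4 := by
    calc B * η ≤ B * (c / (4 * B)) := mul_le_mul_of_nonneg_left (min_le_right _ _) hBpos.le
      _ = c / 4 := by field_simp
  -- the stationary vector
  have hdet₀ : (stationaryMatrix (M z₀)).det ≠ 0 := by
    obtain ⟨j, hj⟩ := hBH.exists_pos_column (Φ ⟨0, Nat.pos_of_ne_zero hB⟩)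
    rw [hM₀]
    refine det_stationaryMatrix_ne_zero (hΔ ε₀ hε₀) (j₀ := j) fun i => ?_
    have h := hj i
    rw [symbolMatrix_apply] at h
    split_ifs at h
    · exact h
    · exact absurd h (lt_irrefl _)
  have hdetc : ContinuousAt (fun z => (stationaryMatrix (M z)).det) z₀ :=
    (ContDiffOn.matrix_det (k := 0) (contDiffOn_stationaryMatrix fun i j => hM i j 0)).continuousOn
      |>.continuousAt (Metric.ball_mem_nhds z₀ hR)
  obtain ⟨r₁, hr₁, hr₁'⟩ := Metric.eventually_nhds_iff_ball.1
    ((hdetc.eventually_ne hdet₀).and (Metric.ball_mem_nhds z₀ hR))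
  have hvec : ∀ i, ∀ k : ℕ,
      ContDiffOn ℂ k (fun z => stationaryVec (M z) i) (Metric.ball z₀ r₁) := fun i k =>
    contDiffOn_stationaryVec (fun i j => (hM i j k).mono fun z hz => (hr₁' z hz).2)
      (fun z hz => (hr₁' z hz).1) i
  -- The chains are given separately for each parameter; uniqueness of the stationary vector is what
  -- makes their laws depend smoothly on it.
  have hlaw : ∀ x ∈ D, dist x ε₀ < R → (stationaryMatrix (M (ofRealPi m x))).det ≠ 0 →
      (fun j => (((P x).real {ω | Y x 0 ω = j} : ℝ) : ℂ)) = stationaryVec (M (ofRealPi m x)) := by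
    intro x hx hxR hdet
    refine eq_stationaryVec hdet ?_ ?_
    · ext j
      have h := congrFun (hY x hx).law_vecMul j
      simp only [Matrix.vecMul, dotProduct, hMΔ x hx hxR, Matrix.map_apply] at h ⊢
      exact_mod_cast h
    · exact_mod_cast (hY x hx).law_mem_stdSimplex.2
  have hnear : ∀ᶠ z in 𝓝 z₀, stationaryVec (M z) ∈ nearStdSimplex B η := by
    have h : ∀ᶠ z in 𝓝 z₀, ∀ i, ‖stationaryVec (M z) i - stationaryVec (M z₀) i‖ < η := by
      rw [eventually_all]
      intro i
      have hcont : ContinuousAt (fun z => stationaryVec (M z) i) z₀ :=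
        (hvec i 0).continuousOn.continuousAt (Metric.ball_mem_nhds z₀ hr₁)
      filter_upwards [hcont (Metric.ball_mem_nhds _ hηpos)] with z hz
      exact mem_ball_iff_norm.1 hz
    filter_upwards [h] with z hz
    refine ⟨_, (hY ε₀ hε₀).law_mem_stdSimplex, fun i => ?_⟩
    have h0 := congrFun (hlaw ε₀ hε₀ (by simpa using hR) hdet₀) i
    rw [h0]
    exact (hz i).le
  -- a ball on which all estimates hold
  set L : ℝ := 16 * B ^ 2 * (2 + B) / c ^ 2 with hL
  -- The contraction factor is `L * τ` with `τ = C * ‖z - z₀‖`, and `A * 2` is the letter count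
  -- times the weight bound.
  set C₁ : ℝ := A * 2 * (L * C) ^ 2 with hC₁
  have hsmall : ∀ K δ : ℝ, 0 < δ → ∀ᶠ t : ℝ in 𝓝 0, K * t < δ := fun K δ hδ => by
    have : Tendsto (fun t : ℝ => K * t) (𝓝 0) (𝓝 (K * 0)) := (continuous_const_mul K).tendsto 0
    rw [mul_zero] at this
    exact this.eventually (gt_mem_nhds hδ)
  obtain ⟨r₂, hr₂, hr₂'⟩ := Metric.eventually_nhds_iff_ball.1 (hlip.and hnear)
  have hev : ∀ᶠ t : ℝ in 𝓝[>] 0, 0 < t ∧ 1 * t < 1 ∧ 1 * t < r₁ ∧ 1 * t < r₂ ∧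
      (2 * B ^ 2 * C) * t < c / 4 ∧ (B * C) * t < 1 ∧
      (2 * B * (1 + B) * C) * t < η * (c / 2) ∧ C₁ * t < 1 / 2 :=
    (eventually_mem_nhdsWithin).and (nhdsWithin_le_nhds
      ((hsmall _ _ one_pos).and ((hsmall _ _ hr₁).and ((hsmall _ _ hr₂).and
        ((hsmall _ _ (by positivity)).and ((hsmall _ _ one_pos).and
          ((hsmall _ _ (by positivity)).and (hsmall _ _ (by norm_num)))))))))
  obtain ⟨r, hr, hr1, hrr₁, hrr₂, hs1, hs2, hs3, hs4⟩ := hev.exists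
  rw [one_mul] at hr1 hrr₁ hrr₂
  have hb1 : ∀ z ∈ Metric.ball z₀ r, z ∈ Metric.ball z₀ r₁ := fun z hz =>
    Metric.ball_subset_ball hrr₁.le hz
  have hb2 : ∀ z ∈ Metric.ball z₀ r, z ∈ Metric.ball z₀ r₂ := fun z hz =>
    Metric.ball_subset_ball hrr₂.le hz
  -- The tolerance is taken proportional to `‖z - z₀‖` instead of uniform on the ball; this yields
  -- the power of the distance that kills the derivatives.
  have hbh : ∀ z ∈ Metric.ball z₀ r, IsNearBlackHole (letterMatrix Φ (M z))
      (symbolMatrix Φ (Δ ε₀)) c (C * ‖z - z₀‖) := fun z hz =>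
    hBH.isNearBlackHole (hΔ ε₀ hε₀) hc (by positivity) fun i j => by
      have h := (hr₂' z (hb2 z hz)).1 (i, j)
      simpa only [hM₀, Matrix.map_apply] using h
  have hτ : ∀ z ∈ Metric.ball z₀ r, 2 * B ^ 2 * (C * ‖z - z₀‖) ≤ c / 4 ∧
      B * (C * ‖z - z₀‖) ≤ 1 ∧ 2 * B * ((1 + B) * (C * ‖z - z₀‖)) ≤ η * (c / 2) := by
    intro z hz
    have hzr : ‖z - z₀‖ ≤ r := (mem_ball_iff_norm.1 hz).le
    refine ⟨le_trans ?_ hs1.le, le_trans ?_ hs2.le, le_trans ?_ hs3.le⟩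
    · rw [← mul_assoc]; gcongr
    · rw [← mul_assoc]; gcongr
    · rw [← mul_assoc, ← mul_assoc]; gcongr
  have hre : ∀ z ∈ Metric.ball z₀ r, ∀ b, ∀ x ∈ nearStdSimplex B η,
      0 < (letterWeight (letterMatrix Φ (M z)) b x).re := fun z hz b x hx =>
    (half_pos hc0).trans_le ((hbh z hz).le_re_letterWeight hη1 hηc (hτ z hz).1 hx b)
  have hstep : ∀ z ∈ Metric.ball z₀ r, ∀ b, ∀ x ∈ nearStdSimplex B η,
      letterStep (letterMatrix Φ (M z)) b x ∈ nearStdSimplex B η := fun z hz b x hx =>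
    (hbh z hz).letterStep_mem hc0 hη1 hηc (hτ z hz).1 (hτ z hz).2.2 hx b
  have hr1' : C₁ * r ^ 2 ≤ 1 / 2 := by
    have h1 : r ^ 2 ≤ r := by nlinarith
    exact (mul_le_mul_of_nonneg_left h1 (by positivity)).trans hs4.le
  refine mixedPartialWithin_limUnder_eq hN hD hε₀
    (f := fun n ε => entropyApprox (P ε) (hiddenChain Φ (Y ε)) n)
    (H := fun n z => stateEntropy (letterMatrix Φ (M z)) n (stationaryVec (M z)))
    (C₀ := A * ((2 * B) ^ 2 / (c / 2)) * (A * 2) * 4 ^ 2) (C₁ := C₁) hr hr1.le (by positivity)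
    hr1' (fun n k => ?_) (fun n z hz => ?_) (fun n x hx hxr => ?_)
  · refine contDiffOn_stateEntropy (K := nearStdSimplex B η) (fun b i j => ?_) hre hstep n
      (fun i => (hvec i k).mono hb1) fun z hz => (hr₂' z (hb2 z hz)).2
    simp only [letterMatrix_apply]
    split_ifs
    · exact (hM i j k).mono fun z hz => (hr₁' z (hb1 z hz)).2
    · exact contDiffOn_const
  · have hdet := (hr₁' z (hb1 z hz)).1
    have h := (hbh z hz).norm_stateEntropy_succ_sub_le hc0 hc1 hη1 hηc (hτ z hz).1 (hτ z hz).2.1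
      (hτ z hz).2.2 (by positivity) (hr₂' z (hb2 z hz)).2 (sum_stationaryVec hB (hMsum z) hdet)
      (by rw [← Matrix.vecMul_sum, sum_letterMatrix, stationaryVec_vecMul hB (hMsum z) hdet]) n
    refine h.trans (le_of_eq ?_)
    congr 2
    ring
  · have hz : ofRealPi m x ∈ Metric.ball z₀ r := by
      rwa [mem_ball_iff_norm, hz₀, ← map_sub, norm_ofRealPi, ← dist_eq_norm]
    have hxR : dist x ε₀ < R := by
      have h := (hr₁' _ (hb1 _ hz)).2
      rwa [dist_eq_norm, hz₀, ← map_sub, norm_ofRealPi, ← dist_eq_norm] at h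
    have hdet := (hr₁' _ (hb1 _ hz)).1
    have h := sum_letterEntropy_wordVec (T := letterMatrix Φ (M (ofRealPi m x)))
      (fun b y hy h0 => by
        have := hre _ hz b y hy
        rw [h0] at this
        exact lt_irrefl _ this)
      (hstep _ hz) n 1 (hr₂' _ (hb2 _ hz)).2 (sum_stationaryVec hB (hMsum _) hdet)
    rw [one_mul, one_smul] at h
    rw [← h, (hY x hx).entropyApprox_eq, hlaw x hx hxR hdet, hMΔ x hx hxR]
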